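/- Let $K=\mathbb{Q}(\sqrt{-3})\subset\mathbb{C}$ with ring of integers $\mathfrak{O}=\mathbb{Z}[e^{i\pi/3}]$, in which every ideal is principal. For $a\in\mathbb{Z}$ let $\chi^{6a}$ be the Hecke character on the nonzero ideals of $\mathfrak{O}$ given by $\chi^{6a}((\mu))=(\mu/|\mu|)^{6a}$ (well defined, since all units of $\mathfrak{O}$ are sixth roots of unity). For $a\neq 0$ let $L(s,\chi^{6a})$ be the Hecke $L$-function, that is, the entire function that for $\mathrm{Re}(s)>1$ is given by the absolutely convergent series $$L(s,\chi^{6a})=\sum_{0\ne\mathfrak{a}\unlhd\mathfrak{O}}\frac{\chi^{6a}(\mathfrak{a})}{N(\mathfrak{a})^{s}}.$$ **Theorem (Zero-free Region).** There exist positive constants $c_5,c_6$ such that for every integer $a\neq 0$ the function $L(s,\chi^{6a})$ (which does continue to an entire function) has no zeros $s=\sigma+it$ in the region defined by $$\sigma\ \geq\ \begin{cases}1-\dfrac{1}{c_5\log\big((1+|a|)(1+|t|)\big)} & \text{for } |t|\geq c_6,\\[2ex] 1-\dfrac{1}{c_5\log\big((1+|a|)(1+|c_6|)\big)} & \text{for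 } |t|\leq c_6.\end{cases}$$ The constants $c_5,c_6$ do not depend on $a$. -/

import Mathlib

open scoped NumberField

namespace EisensteinHecke

/-- `√-3 = i√3` as a complex number. -/
noncomputable def sqrtNegThree : ℂ := (Real.sqrt 3 : ℂ) * Complex.I

/-- The number field `K = ℚ(√-3)`, as a subfield of `ℂ`.  Its ring of integers is `𝓞 K`. -/
noncomputable abbrev K : IntermediateField ℚ ℂ := IntermediateField.adjoin ℚ {sqrtNegThree}

lemma sqrtNegThree_sq : sqrtNegThree ^ 2 = -3 := by
  have h : ((Real.sqrt 3 : ℝ) : ℂ) ^ 2 = 3 := by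
    rw [← Complex.ofReal_pow, Real.sq_sqrt (by norm_num)]; norm_num
  rw [sqrtNegThree, mul_pow, h, Complex.I_sq]; norm_num

/-- The primitive cube root of unity `(-1 + √-3) / 2`. -/
noncomputable def zetaThree : ℂ := (-1 + sqrtNegThree) / 2

lemma isPrimitiveRoot_zetaThree : IsPrimitiveRoot zetaThree 3 := by
  have h := sqrtNegThree_sq
  rw [IsPrimitiveRoot.iff_orderOf]
  refine orderOf_eq_prime ?_ ?_
  · rw [zetaThree]
    linear_combination (sqrtNegThree / 8 - 3 / 8) * h
  · intro h1
    have h2 : sqrtNegThree = 3 := by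
      rw [zetaThree] at h1
      linear_combination 2 * h1
    rw [h2] at h
    norm_num at h

lemma K_eq_adjoin_zetaThree : K = IntermediateField.adjoin ℚ {zetaThree} := by
  apply le_antisymm
  · rw [IntermediateField.adjoin_simple_le_iff]
    have hz := IntermediateField.mem_adjoin_simple_self ℚ zetaThree
    have h : sqrtNegThree = zetaThree + zetaThree + 1 := by rw [zetaThree]; ring
    rw [h]
    exact add_mem (add_mem hz hz) (one_mem _)
  · rw [IntermediateField.adjoin_simple_le_iff]
    have hz := IntermediateField.mem_adjoin_simple_self ℚ sqrtNegThree
    have h2 : (2 : ℂ) ∈ K := by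
      have := add_mem (one_mem K) (one_mem K)
      rwa [one_add_one_eq_two] at this
    exact div_mem (add_mem (neg_mem (one_mem _)) hz) h2

instance : IsCyclotomicExtension {3} ℚ K :=
  (IntermediateField.isCyclotomicExtension_singleton_iff_eq_adjoin 3 ℚ ℂ K
    isPrimitiveRoot_zetaThree).2 K_eq_adjoin_zetaThree

instance : NumberField K := IsCyclotomicExtension.numberField {3} ℚ K

instance : IsPrincipalIdealRing (𝓞 K) := IsCyclotomicExtension.Rat.three_pid K

/-- The value `(μ / |μ|) ^ (6a)` at an element `μ` of the ring of integers of `K ⊆ ℂ`. -/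
noncomputable def angularChar (a : ℤ) (μ : 𝓞 K) : ℂ :=
  (((μ : K) : ℂ) / (‖((μ : K) : ℂ)‖ : ℂ)) ^ (6 * a)

/-- The Hecke character `χ^{6a}` on the ideals of `𝓞 K`: its value at `(μ)` is
`(μ / |μ|) ^ (6a)`, for any generator `μ`; see `heckeChar_span`. -/
noncomputable def heckeChar (a : ℤ) (I : Ideal (𝓞 K)) : ℂ :=
  angularChar a (Submodule.IsPrincipal.generator I)

lemma unit_pow_six (u : (𝓞 K)ˣ) : u ^ 6 = 1 := by
  have hζ := IsCyclotomicExtension.zeta_spec 3 ℚ K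
  have hu := IsCyclotomicExtension.Rat.Three.Units.mem hζ u
  set η := (IsPrimitiveRoot.isUnit (hζ.toInteger_isPrimitiveRoot) (by decide)).unit with hη
  have h3 : η ^ 3 = 1 := by
    ext
    simp [hη, IsPrimitiveRoot.toInteger_cube_eq_one]
  have h6 : η ^ 6 = 1 := by rw [show 6 = 3 * 2 from rfl, pow_mul, h3, one_pow]
  have h12 : (η ^ 2) ^ 6 = 1 := by rw [← pow_mul, mul_comm, pow_mul, h6, one_pow]
  have heven : Even 6 := by decide
  simp only [List.mem_cons, List.not_mem_nil, or_false] at hu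
  rcases hu with h | h | h | h | h | h <;> rw [h]
  · exact one_pow 6
  · rw [heven.neg_pow, one_pow]
  · exact h6
  · rw [heven.neg_pow, h6]
  · exact h12
  · rw [heven.neg_pow, h12]

/-- The value of `heckeChar` at `(μ)` does not depend on the generator. -/
theorem heckeChar_span (a : ℤ) (μ : 𝓞 K) :
    heckeChar a (Ideal.span {μ}) = angularChar a μ := by
  have h : Associated μ (Submodule.IsPrincipal.generator (Ideal.span {μ})) := by
    rw [← Ideal.span_singleton_eq_span_singleton, Ideal.span_singleton_generator]
  obtain ⟨u, hu⟩ := h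
  have h6 : (((u : 𝓞 K) : K) : ℂ) ^ 6 = 1 := by
    have := congrArg (fun v : (𝓞 K)ˣ => (((v : 𝓞 K) : K) : ℂ)) (unit_pow_six u)
    simpa using this
  have hn : ‖(((u : 𝓞 K) : K) : ℂ)‖ = 1 := Complex.norm_eq_one_of_pow_eq_one h6 (by norm_num)
  rw [heckeChar, ← hu, angularChar, angularChar]
  push_cast
  rw [norm_mul, hn, mul_one, mul_div_right_comm, mul_zpow, zpow_mul _ 6 a,
    zpow_mul (((u : 𝓞 K) : K) : ℂ) 6 a]
  have h6' : (((u : 𝓞 K) : K) : ℂ) ^ (6 : ℤ) = 1 := by exact_mod_cast h6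
  rw [h6', one_zpow, mul_one]

/-- The general term `χ^{6a}(𝔞) / N(𝔞)^s` of the series of `L(s, χ^{6a})`, with `𝔞` running
through the nonzero ideals of `𝓞 K`. -/
noncomputable def heckeTerm (a : ℤ) (s : ℂ) (I : {I : Ideal (𝓞 K) // I ≠ ⊥}) : ℂ :=
  heckeChar a I.1 / (Ideal.absNorm I.1 : ℂ) ^ s

/-- `L` is an entire function which, on the half-plane `Re s > 1`, is the sum of the (absolutely
convergent) series `∑ χ^{6a}(𝔞) / N(𝔞)^s` over the nonzero ideals `𝔞` of `𝓞 K`. -/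
structure IsHeckeLFunction (a : ℤ) (L : ℂ → ℂ) : Prop where
  differentiable : Differentiable ℂ L
  hasSum : ∀ s : ℂ, 1 < s.re → HasSum (heckeTerm a s) (L s)

/-- The analytic continuation is unique. -/
theorem IsHeckeLFunction.unique {a : ℤ} {L M : ℂ → ℂ} (hL : IsHeckeLFunction a L)
    (hM : IsHeckeLFunction a M) : L = M := by
  have hU : IsOpen {s : ℂ | 1 < s.re} := isOpen_lt continuous_const Complex.continuous_re
  refine AnalyticOnNhd.eq_of_eventuallyEq (z₀ := 2)
    (fun z _ => hL.differentiable.analyticAt z) (fun z _ => hM.differentiable.analyticAt z) ?_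
  filter_upwards [hU.mem_nhds (show (2 : ℂ) ∈ {s : ℂ | 1 < s.re} by simp)] with s hs
  exact (hL.hasSum s hs).unique (hM.hasSum s hs)

open Classical in
/-- The Hecke L-function `s ↦ L(s, χ^{6a})`, for `a ≠ 0`: the entire continuation of the series.
(The value `0` is used only if there is no such continuation.) -/
noncomputable def heckeL (a : ℤ) : ℂ → ℂ :=
  if h : ∃ L : ℂ → ℂ, IsHeckeLFunction a L then h.choose else 0

end EisensteinHecke

namespace EisensteinHecke

/-! ### Landau's lemma on the logarithmic derivative at the centre of a disc. -/

open Complex Metric Filter Topology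

/-! This is the de la Vallée Poussin argument, kept uniform in `a`. The inequality `3 + 4 cos θ +
cos 2θ ≥ 0`, applied to the Euler factors of the trivial character, `χ^{6a}` and `χ^{12a}`, yields
`three_four_one`: at `1 + η`, `1 + η + it`, `1 + η + 2it` the real parts of the three logarithmic
derivatives, weighted 3, 4, 1, have sum at most 0. The zeta term costs about `3/η`
(`exists_neg_logDeriv_zeta_le`), while a zero `β + it` contributes `4/(1 + η - β)`. With `β` very
close to 1 the gain exceeds the cost, provided everything else is `O(log((1+|a|)(1+|t|)))`. Since
`2a ≠ 0`, the function for `χ^{12a}` has no pole, so even real zeros need no special treatment.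

The error control is `landau_lower_bound`: on a unit disc the logarithmic derivative at the centre
is governed by the growth of the function, zeros in the left half only helping. It needs a lower
bound at the centre, supplied by the Euler product (`one_le_norm_heckeSum_mul_zetaSum`), and a
polynomial upper bound in `a` and `t` slightly to the left of the line `Re s = 1`
(`norm_heckeL_le`).

The upper bound, like the continuation itself, comes from Hecke's functional equation. The theta
series `∑ x^k exp(-πα|x|²)` are Taylor coefficients of one generating function in an auxiliary
variable `w`; that function is a combination of products of Jacobi theta functions, so Jacobi's
inversion formula gives the transformation law for all `k` at once
(`harmonicTheta_functional_equation`). Its Mellin transform is the completed L-function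
(`completedHecke_eq`), and Phragmén–Lindelöf between `Re s = -1/2` and `Re s = 3/2` gives the bound.
-/

lemma norm_logDeriv_le_of_norm_le {F : ℂ → ℂ} {M : ℝ} (hM : 0 < M) (hF : Differentiable ℂ F)
    (h0 : ∀ z ∈ ball (0 : ℂ) 1, F z ≠ 0)
    (hb : ∀ z ∈ ball (0 : ℂ) 1, ‖F z‖ ≤ Real.exp M * ‖F 0‖) :
    ‖logDeriv F 0‖ ≤ 2 * M := by
  have h00 : (0 : ℂ) ∈ ball (0 : ℂ) 1 := by simp
  have hd : DifferentiableOn ℂ (fun z => deriv F z / F z) (ball 0 1) := by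
    have h1 : Differentiable ℂ (deriv F) :=
      fun z => (hF.analyticAt z).deriv.differentiableAt
    exact h1.differentiableOn.div hF.differentiableOn h0
  -- `G` is a branch of `log (F / F 0)` on the disc. Its real part is at most `M`, so
  -- Borel–Carathéodory bounds `‖G z‖ / ‖z‖`, and `z → 0` bounds `G' 0`.
  obtain ⟨G, hG0, hG⟩ := hd.isExactOn_ball.with_val_at 0 0
  have hFG : ∀ z ∈ ball (0 : ℂ) 1, F z = F 0 * exp (G z) := by
    have hk : ∀ z ∈ ball (0 : ℂ) 1, HasDerivAt (fun z => F z * exp (-G z)) 0 z := by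
      intro z hz
      have h : HasDerivAt (fun z => F z * exp (-G z))
          (deriv F z * exp (-G z) + F z * (exp (-G z) * -(deriv F z / F z))) z :=
        (hF z).hasDerivAt.mul (hG z hz).neg.cexp
      refine h.congr_deriv ?_
      have e : F z * (deriv F z / F z) = deriv F z := mul_div_cancel₀ _ (h0 z hz)
      linear_combination -exp (-G z) * e
    intro z hz
    have hc : F z * exp (-G z) = F 0 * exp (-G 0) := by
      refine (convex_ball (0 : ℂ) 1).is_const_of_fderivWithin_eq_zero (𝕜 := ℂ)
        (f := fun z => F z * exp (-G z))
        (fun w hw => (hk w hw).differentiableAt.differentiableWithinAt) (fun w hw => ?_) hz h00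
      rw [fderivWithin_of_isOpen isOpen_ball hw, (hk w hw).hasFDerivAt.fderiv]
      simp
    rw [hG0, neg_zero, exp_zero, mul_one] at hc
    rw [← hc, mul_assoc, ← exp_add]
    simp
  have hre : Set.MapsTo G (ball 0 1) {z | z.re ≤ M} := by
    intro z hz
    have h1 := hb z hz
    rw [hFG z hz, norm_mul, mul_comm, norm_exp] at h1
    exact Real.exp_le_exp.1 (le_of_mul_le_mul_right h1 (norm_pos_iff.2 (h0 0 h00)))
  have hGd : DifferentiableOn ℂ G (ball 0 1) :=
    fun z hz => (hG z hz).differentiableAt.differentiableWithinAt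
  have hbc : ∀ z ∈ ball (0 : ℂ) 1, ‖G z‖ ≤ 2 * M * ‖z‖ / (1 - ‖z‖) := fun z hz =>
    borelCaratheodory_zero hM hGd hre one_pos hz hG0
  rw [logDeriv_apply]
  have hlim : Tendsto (fun z : ℂ => 2 * M / (1 - ‖z‖)) (𝓝[≠] 0) (𝓝 (2 * M / (1 - ‖(0 : ℂ)‖))) := by
    refine Tendsto.mono_left (ContinuousAt.tendsto ?_) nhdsWithin_le_nhds
    refine ContinuousAt.div (by fun_prop) (by fun_prop) (by simp)
  have hs := ((hG 0 h00).tendsto_slope).norm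
  refine le_of_tendsto_of_tendsto hs (by simpa using hlim) ?_
  filter_upwards [self_mem_nhdsWithin, nhdsWithin_le_nhds (ball_mem_nhds (0 : ℂ) one_pos)]
    with z hz hz1
  have hz0 : 0 < ‖z‖ := norm_pos_iff.2 hz
  rw [slope_def_field, hG0, sub_zero, sub_zero, norm_div, div_le_iff₀ hz0]
  have := hbc z hz1
  rwa [mul_div_right_comm] at this

lemma norm_le_of_norm_le_sphere {f : ℂ → ℂ} (hf : Differentiable ℂ f) {R C : ℝ} (hR : 0 < R)
    (h : ∀ z, ‖z‖ = R → ‖f z‖ ≤ C) {z : ℂ} (hz : ‖z‖ ≤ R) : ‖f z‖ ≤ C := by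
  refine norm_le_of_forall_mem_frontier_norm_le (U := ball 0 R) isBounded_ball
    hf.diffContOnCl (fun w hw => h w ?_) ?_
  · rw [frontier_ball _ hR.ne'] at hw
    simpa using hw
  · rw [closure_ball _ hR.ne']
    simpa using hz

/-- Divide out as many zeros of the closed unit disc as possible, with multiplicity; a Jensen-type
estimate shows that this stops. -/
lemma exists_factorization {f : ℂ → ℂ} (hf : Differentiable ℂ f) (h0 : f 0 ≠ 0) :
    ∃ (n : ℕ) (ρ : Fin n → ℂ) (h : ℂ → ℂ), Differentiable ℂ h ∧
      (∀ z, f z = (∏ i, (z - ρ i)) * h z) ∧ (∀ i, ‖ρ i‖ ≤ 1) ∧ ∀ z, ‖z‖ ≤ 1 → h z ≠ 0 := by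
  let P : ℕ → Prop := fun n => ∃ (ρ : Fin n → ℂ) (h : ℂ → ℂ), Differentiable ℂ h ∧
      (∀ z, f z = (∏ i, (z - ρ i)) * h z) ∧ (∀ i, ‖ρ i‖ ≤ 1)
  obtain ⟨B, hB⟩ := (isCompact_sphere (0 : ℂ) 3).exists_bound_of_continuousOn
    hf.continuous.continuousOn
  -- On `‖z‖ = 3` each factor `z - ρ i` has norm at least 2, while at the origin it has norm at most
  -- 1; the maximum principle for `h` compares the two.
  have hbd : ∀ n, P n → 2 ^ n * ‖f 0‖ ≤ B := by
    rintro n ⟨ρ, h, hh, hfac, hρ⟩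
    have h3 : ∀ z, ‖z‖ = 3 → ‖h z‖ ≤ B / 2 ^ n := by
      intro z hz
      have h1 := hB z (by simpa using hz)
      rw [hfac, norm_mul, norm_prod] at h1
      have h2 : (2 : ℝ) ^ n ≤ ∏ i, ‖z - ρ i‖ := by
        calc (2 : ℝ) ^ n = ∏ _i : Fin n, (2 : ℝ) := by simp
          _ ≤ _ := Finset.prod_le_prod (fun _ _ => by norm_num) (fun i _ => by
              have := norm_sub_norm_le z (ρ i)
              have := hρ i
              linarith)
      rw [le_div_iff₀ (by positivity), mul_comm]
      exact (mul_le_mul_of_nonneg_right h2 (norm_nonneg _)).trans h1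
    have h4 := norm_le_of_norm_le_sphere hh (by norm_num : (0 : ℝ) < 3) h3 (z := 0) (by simp)
    have h5 : ‖f 0‖ ≤ ‖h 0‖ := by
      rw [hfac, norm_mul, norm_prod]
      refine mul_le_of_le_one_left (norm_nonneg _) (Finset.prod_le_one (fun _ _ => norm_nonneg _)
        (fun i _ => by simpa using hρ i))
    rw [le_div_iff₀ (by positivity), mul_comm] at h4
    exact (mul_le_mul_of_nonneg_left h5 (by positivity)).trans h4
  have hP0 : P 0 := ⟨Fin.elim0, f, hf, by simp, fun i => i.elim0⟩
  obtain ⟨N, hN⟩ : ∃ N : ℕ, ∀ n, P n → n ≤ N := by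
    obtain ⟨N, hN⟩ := pow_unbounded_of_one_lt (B / ‖f 0‖) (one_lt_two (α := ℝ))
    refine ⟨N, fun n hn => ?_⟩
    by_contra hlt
    have h1 := hbd n hn
    rw [← le_div_iff₀ (norm_pos_iff.2 h0)] at h1
    have h2 : (2 : ℝ) ^ N ≤ 2 ^ n := pow_le_pow_right₀ one_le_two (by omega)
    linarith
  classical
  have hex : ∃ m, ¬ P (m + 1) := ⟨N, fun h => by have := hN _ h; omega⟩
  have hPm : P (Nat.find hex) := by
    rcases hm : Nat.find hex with _ | m
    · exact hP0
    · have := Nat.find_min hex (m := m) (by omega)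
      exact not_not.1 this
  obtain ⟨ρ, h, hh, hfac, hρ⟩ := hPm
  -- A remaining zero `a` of `h` could be divided out through `dslope h a`, against the maximality
  -- of the number of factors.
  refine ⟨_, ρ, h, hh, hfac, hρ, fun a ha hz => Nat.find_spec hex ?_⟩
  refine ⟨Fin.cons a ρ, dslope h a, ?_, fun z => ?_, fun i => ?_⟩
  · rw [← differentiableOn_univ, differentiableOn_dslope univ_mem]
    exact hh.differentiableOn
  · rw [Fin.prod_univ_succ]
    simp only [Fin.cons_zero, Fin.cons_succ]
    have := sub_smul_dslope h a z
    rw [hz, sub_zero, smul_eq_mul] at this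
    rw [hfac, ← this]
    ring
  · refine Fin.cases ?_ (fun j => ?_) i
    · simpa using ha
    · simpa using hρ j

/-- **Landau's lemma**: for an entire function with all its zeros in the unit disc in the left
half-plane, the logarithmic derivative at the origin is bounded below, with the gain `1 / d - d`
from a zero at `-d`. -/
theorem landau_lower_bound {f : ℂ → ℂ} {M d : ℝ} (hM : 0 < M) (hf : Differentiable ℂ f)
    (h0 : f 0 ≠ 0) (hb : ∀ z, ‖z‖ = 1 → ‖f z‖ ≤ Real.exp M * ‖f 0‖)
    (hz : ∀ z, ‖z‖ ≤ 1 → f z = 0 → z.re ≤ 0) :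
    -(2 * M) ≤ (logDeriv f 0).re ∧
    (0 < d → d ≤ 1 → f (-d) = 0 → 1 / d - d - 2 * M ≤ (logDeriv f 0).re) := by
  obtain ⟨n, ρ, h, hh, hfac, hρ, hh0⟩ := exists_factorization hf h0
  have hρ0 : ∀ i, ρ i ≠ 0 := by
    intro i hi
    apply h0
    rw [hfac, Finset.prod_eq_zero (Finset.mem_univ i) (by simp [hi]), zero_mul]
  have hρf : ∀ i, f (ρ i) = 0 := by
    intro i
    rw [hfac, Finset.prod_eq_zero (Finset.mem_univ i) (by simp), zero_mul]
  have hρre : ∀ i, (ρ i).re ≤ 0 := fun i => hz _ (hρ i) (hρf i)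
  set c : ℂ → ℂ := fun w => starRingEnd ℂ w with hc
  -- Each zero is reflected in the unit circle: `F` has the same norm as `f` on the circle, no zeros
  -- in the open disc, and is at least as large as `f` at the origin.
  set F : ℂ → ℂ := fun z => (∏ i, (1 - c (ρ i) * z)) * h z with hFdef
  have hFd : Differentiable ℂ F := by
    have : Differentiable ℂ (fun z : ℂ => ∏ i, (1 - c (ρ i) * z)) := by fun_prop
    exact this.mul hh
  have hne : ∀ i, ∀ z ∈ ball (0 : ℂ) 1, 1 - c (ρ i) * z ≠ 0 := by
    intro i z hz hzero
    have h1 : c (ρ i) * z = 1 := (sub_eq_zero.1 hzero).symm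
    have h2 : ‖c (ρ i) * z‖ = 1 := by rw [h1]; simp
    rw [norm_mul, hc, RCLike.norm_conj] at h2
    have h3 : ‖z‖ < 1 := by simpa using hz
    nlinarith [hρ i, norm_nonneg z, norm_nonneg (ρ i)]
  have hF0 : F 0 = h 0 := by simp [hFdef]
  have hf0F : ‖f 0‖ ≤ ‖F 0‖ := by
    rw [hF0, hfac, norm_mul, norm_prod]
    refine mul_le_of_le_one_left (norm_nonneg _) (Finset.prod_le_one (fun _ _ => norm_nonneg _)
        (fun i _ => by simpa using hρ i))
  have hFs : ∀ z, ‖z‖ = 1 → ‖F z‖ ≤ Real.exp M * ‖F 0‖ := by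
    intro z hz1
    have hfz : ‖F z‖ = ‖f z‖ := by
      rw [hFdef, hfac, norm_mul, norm_mul, norm_prod, norm_prod]
      congr 1
      refine Finset.prod_congr rfl fun i _ => ?_
      have h1 : (1 : ℂ) = c z * z := by
        rw [hc]
        simp only
        rw [← normSq_eq_conj_mul_self, normSq_eq_norm_sq, hz1]; simp
      have h2 : 1 - c (ρ i) * z = c (z - ρ i) * z := by
        rw [h1]; simp only [hc, map_sub]; ring
      rw [h2, norm_mul, hz1, mul_one, hc, RCLike.norm_conj]
    rw [hfz]
    exact (hb z hz1).trans (mul_le_mul_of_nonneg_left hf0F (Real.exp_nonneg _))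
  have hlog : ‖logDeriv F 0‖ ≤ 2 * M := by
    refine norm_logDeriv_le_of_norm_le hM hFd (fun z hz => ?_) (fun z hz => ?_)
    · refine mul_ne_zero (Finset.prod_ne_zero_iff.2 fun i _ => hne i z hz) (hh0 z ?_)
      have : ‖z‖ < 1 := by simpa using hz
      exact this.le
    · refine norm_le_of_norm_le_sphere hFd one_pos hFs ?_
      have : ‖z‖ < 1 := by simpa using hz
      exact this.le
  have hh00 : h 0 ≠ 0 := hh0 0 (by simp)
  have e1 : logDeriv F 0 = (∑ i, -c (ρ i)) + logDeriv h 0 := by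
    rw [hFdef, logDeriv_mul (f := fun z => ∏ i, (1 - c (ρ i) * z)) (g := h) 0
      (by simp) hh00 (by fun_prop) (hh 0), logDeriv_prod (by simp) (fun i _ => by fun_prop)]
    congr 1
    refine Finset.sum_congr rfl fun i _ => ?_
    rw [logDeriv_apply]
    have : HasDerivAt (fun z : ℂ => 1 - c (ρ i) * z) (-c (ρ i)) 0 := by
      simpa using ((hasDerivAt_id (0 : ℂ)).const_mul (c (ρ i))).const_sub 1
    rw [this.deriv]; simp
  have e2 : logDeriv f 0 = (∑ i, (-(ρ i)⁻¹)) + logDeriv h 0 := by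
    have : f = fun z => (∏ i, (z - ρ i)) * h z := funext hfac
    rw [this, logDeriv_mul (f := fun z => ∏ i, (z - ρ i)) (g := h) 0
      (by simp [Finset.prod_ne_zero_iff, hρ0]) hh00 (by fun_prop) (hh 0),
      logDeriv_prod (by simp [hρ0]) (fun i _ => by fun_prop)]
    congr 1
    refine Finset.sum_congr rfl fun i _ => ?_
    rw [logDeriv_apply]
    have : HasDerivAt (fun z : ℂ => z - ρ i) 1 0 := by
      simpa using (hasDerivAt_id (0 : ℂ)).sub_const (ρ i)
    rw [this.deriv, zero_sub, one_div, inv_neg]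
  have e3 : (logDeriv f 0).re = (logDeriv F 0).re + ∑ i, (-(ρ i)⁻¹ + c (ρ i)).re := by
    rw [e1, e2]
    simp only [add_re, re_sum, Finset.sum_add_distrib, neg_re, Finset.sum_neg_distrib]
    ring
  -- This real part is `-(ρ i).re * (1 / |ρ i|² - 1)`, so a zero in the left half of the disc can
  -- only increase the logarithmic derivative.
  have hnn : ∀ i, 0 ≤ (-(ρ i)⁻¹ + c (ρ i)).re := by
    intro i
    have h1 : 0 < normSq (ρ i) := normSq_pos.2 (hρ0 i)
    have h2 : normSq (ρ i) ≤ 1 := by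
      rw [normSq_eq_norm_sq]; exact pow_le_one₀ (norm_nonneg _) (hρ i)
    simp only [hc, add_re, neg_re, inv_re, conj_re]
    rw [← neg_div]
    have : -(ρ i).re ≤ -(ρ i).re / normSq (ρ i) := by
      rw [le_div_iff₀ h1]
      nlinarith [hρre i]
    linarith
  have hlow : -(2 * M) ≤ (logDeriv F 0).re := by
    have := neg_le_of_abs_le ((abs_re_le_norm _).trans hlog)
    linarith
  constructor
  · rw [e3]
    have := Finset.sum_nonneg fun i (_ : i ∈ Finset.univ) => hnn i
    linarith
  · intro hd hd1 hfd
    have hex : ∃ i, ρ i = -d := by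
      rw [hfac, mul_eq_zero] at hfd
      rcases hfd with h1 | h1
      · obtain ⟨i, _, hi⟩ := Finset.prod_eq_zero_iff.1 h1
        exact ⟨i, (sub_eq_zero.1 hi).symm⟩
      · exact absurd h1 (hh0 _ (by simpa [abs_of_pos hd] using hd1))
    obtain ⟨i, hi⟩ := hex
    have h1 := Finset.single_le_sum (fun i _ => hnn i) (Finset.mem_univ i)
    have h2 : (-(ρ i)⁻¹ + c (ρ i)).re = 1 / d - d := by
      rw [hi, inv_neg, neg_neg, ← ofReal_inv]
      simp [hc, sub_eq_add_neg]
    rw [h2] at h1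
    rw [e3]
    linarith

/-! ### Euler products over the ideals of a Dedekind domain. -/

section EulerProduct

variable {A : Type*} [CommRing A] [IsDedekindDomain A]

lemma prime_dvd_mul_iff_of_ne {P Q J : Ideal A} (hP : Prime P) (hQ : Prime Q) (h : P ≠ Q) :
    Q ∣ P * J ↔ Q ∣ J := by
  rw [hQ.dvd_mul]
  refine ⟨fun h1 => h1.resolve_left fun h2 => ?_, Or.inr⟩
  exact h (associated_iff_eq.1 ((hQ.dvd_prime_iff_associated hP).1 h2)).symm

/-- Sieve of Eratosthenes: multiplying by `1 - f P` removes the surviving multiples of `P`, since `J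
↦ P * J` carries the ideals prime to `S` onto the multiples of `P` prime to `S`. -/
theorem tsum_mul_prod_one_sub {f : Ideal A →*₀ ℂ} (hf : Summable fun I => ‖f I‖)
    (S : Finset (Ideal A)) (hS : ∀ P ∈ S, Prime P) :
    (∑' I, f I) * ∏ P ∈ S, (1 - f P) = ∑' I, Set.indicator {I | ∀ P ∈ S, ¬ P ∣ I} f I := by
  classical
  induction S using Finset.induction_on with
  | empty => simp
  | insert P S hPS ih =>
    have hP : Prime P := hS P (Finset.mem_insert_self _ _)
    have hS' : ∀ Q ∈ S, Prime Q := fun Q hQ => hS Q (Finset.mem_insert_of_mem hQ)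
    have hsum : ∀ s : Set (Ideal A), Summable (Set.indicator s f) := fun s =>
      (hf.of_norm).indicator s
    rw [Finset.prod_insert hPS, mul_left_comm, ih hS']
    set T : Set (Ideal A) := {I | ∀ Q ∈ S, ¬ Q ∣ I} with hT
    have h1 : ∀ I, Set.indicator {I | ∀ Q ∈ insert P S, ¬ Q ∣ I} f I
        = Set.indicator T f I - Set.indicator (T ∩ {I | P ∣ I}) f I := by
      intro I
      by_cases hI : I ∈ T <;> by_cases hPI : P ∣ I <;>
        simp_all [Set.indicator_apply]
    have hinj : Function.Injective (fun J : Ideal A => P * J) := fun J J' h =>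
      mul_left_cancel₀ hP.ne_zero h
    have h2 : ∑' I, Set.indicator (T ∩ {I | P ∣ I}) f I = f P * ∑' I, Set.indicator T f I := by
      rw [← tsum_mul_left, ← hinj.tsum_eq]
      · refine tsum_congr fun J => ?_
        have : P * J ∈ T ∩ {I | P ∣ I} ↔ J ∈ T := by
          simp only [hT, Set.mem_inter_iff, Set.mem_ofPred_eq, dvd_mul_right, and_true]
          refine forall₂_congr fun Q hQ => not_congr (prime_dvd_mul_iff_of_ne hP (hS' Q hQ) ?_)
          rintro rfl
          exact hPS hQ
        by_cases hJ : J ∈ T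
        · rw [Set.indicator_of_mem (this.2 hJ), Set.indicator_of_mem hJ, map_mul]
        · rw [Set.indicator_of_notMem (fun h => hJ (this.1 h)), Set.indicator_of_notMem hJ,
            mul_zero]
      · intro I hI
        obtain ⟨J, hJ⟩ := (Set.mem_of_indicator_ne_zero hI).2
        exact ⟨J, hJ.symm⟩
    simp_rw [h1]
    rw [(hsum _).tsum_sub (hsum _), h2]
    ring

theorem tendstoUniformlyOn_tsum_mul_prod_one_sub {ι : Type*} {f : ι → Ideal A → ℂ} {U : Set ι}
    {u : Ideal A → ℝ} (hu : Summable u) (hf : ∀ s ∈ U, ∀ I, ‖f s I‖ ≤ u I)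
    (hmul : ∀ s ∈ U, ∃ g : Ideal A →*₀ ℂ, f s = g) :
    TendstoUniformlyOn (fun (S : Finset {P : Ideal A // Prime P}) s =>
      (∑' I, f s I) * ∏ P ∈ S, (1 - f s P)) (fun _ => 1) atTop U := by
  classical
  rw [Metric.tendstoUniformlyOn_iff]
  intro ε hε
  -- Once `S'` contains a prime factor of every ideal in `T` other than 0 and 1, what survives the
  -- sieve besides the ideal 1 lies outside `T` or contributes 0. The tail of `u` bounds it
  -- uniformly in `s`.
  obtain ⟨T, hT⟩ := ((tendsto_tsum_compl_atTop_zero u).eventually (gt_mem_nhds hε)).exists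
  have hex : ∀ I : Ideal A, ∃ S : Finset {P : Ideal A // Prime P},
      I ≠ 0 → I ≠ 1 → ∃ P ∈ S, P.1 ∣ I := by
    intro I
    by_cases h : I ≠ 0 ∧ I ≠ 1
    · have hu' : ¬ IsUnit I := fun hu => h.2 (by rwa [Ideal.isUnit_iff, ← Ideal.one_eq_top] at hu)
      obtain ⟨P, hP, hPI⟩ := WfDvdMonoid.exists_irreducible_factor hu' h.1
      have hP' : Prime P := hP.prime
      refine ⟨{⟨P, hP'⟩}, fun _ _ => ⟨⟨P, hP'⟩, ?_, hPI⟩⟩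
      exact Finset.mem_singleton_self _
    · exact ⟨∅, fun h1 h2 => absurd ⟨h1, h2⟩ h⟩
  choose S hS using hex
  filter_upwards [eventually_ge_atTop (T.biUnion S)] with S' hS' s hs
  have hsn : Summable fun I => ‖f s I‖ :=
    hu.of_nonneg_of_le (fun _ => norm_nonneg _) (hf s hs)
  have hu0 : ∀ I, 0 ≤ u I := fun I => (norm_nonneg _).trans (hf s hs I)
  have hfs := hf s hs
  obtain ⟨g, hg⟩ := hmul s hs
  simp only [hg] at hsn hfs ⊢
  have e := tsum_mul_prod_one_sub hsn (S'.map (Function.Embedding.subtype _))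
    (by simp only [Finset.mem_map]; rintro _ ⟨P, _, rfl⟩; exact P.2)
  rw [Finset.prod_map] at e
  simp only [Function.Embedding.subtype_apply] at e
  set C : Set (Ideal A) := {I | ∀ P ∈ S'.map (Function.Embedding.subtype _), ¬ P ∣ I} with hC
  have h1C : (1 : Ideal A) ∈ C := by
    simp only [hC, Finset.mem_map, Set.mem_ofPred_eq]
    rintro P ⟨Q, _, rfl⟩ hdvd
    exact Q.2.not_isUnit (isUnit_of_dvd_one hdvd)
  have hfC : Summable (Set.indicator C g) := hsn.of_norm.indicator C
  have hle : ∀ I, ‖if I = 1 then 0 else Set.indicator C g I‖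
      ≤ Set.indicator ((T : Set (Ideal A))ᶜ) u I := by
    intro I
    by_cases hI1 : I = 1
    · simp only [hI1, if_true, norm_zero]
      exact Set.indicator_nonneg (fun _ _ => hu0 _) _
    rw [if_neg hI1]
    by_cases hIT : I ∈ T
    · have : Set.indicator C g I = 0 := by
        by_cases hI0 : I = 0
        · by_cases h : I ∈ C
          · rw [Set.indicator_of_mem h, hI0, map_zero]
          · rw [Set.indicator_of_notMem h]
        · refine Set.indicator_of_notMem (fun hIC => ?_) _
          obtain ⟨P, hP, hPI⟩ := hS I hI0 hI1
          exact hIC P (Finset.mem_map.2 ⟨P, hS' (Finset.mem_biUnion.2 ⟨I, hIT, hP⟩), rfl⟩) hPI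
      rw [this, norm_zero]
      exact Set.indicator_nonneg (fun _ _ => hu0 _) _
    · rw [Set.indicator_of_mem (s := (T : Set (Ideal A))ᶜ) (by simpa using hIT)]
      refine (norm_indicator_le_norm_self _ _).trans (hfs I)
  have hsumu : Summable (Set.indicator ((T : Set (Ideal A))ᶜ) u) := hu.indicator _
  rw [e, dist_comm, dist_eq_norm, hfC.tsum_eq_add_tsum_ite 1, Set.indicator_of_mem h1C, map_one,
    add_sub_cancel_left]
  refine (tsum_of_norm_bounded hsumu.hasSum hle).trans_lt ?_
  have : ∑' I, Set.indicator ((T : Set (Ideal A))ᶜ) u I = ∑' I : {I // I ∉ T}, u I :=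
    (tsum_subtype _ _).symm
  rwa [this]

end EulerProduct


/-! ### The Dirichlet series on the half-plane of absolute convergence. -/

section Terms

lemma angularChar_mul (a : ℤ) (x y : 𝓞 K) :
    angularChar a (x * y) = angularChar a x * angularChar a y := by
  rw [angularChar, angularChar, angularChar, ← mul_zpow]
  push_cast
  rw [norm_mul]
  push_cast
  rw [mul_div_mul_comm]

lemma coe_ne_zero {x : 𝓞 K} (hx : x ≠ 0) : ((x : K) : ℂ) ≠ 0 := by
  simpa using hx

lemma norm_angularChar (a : ℤ) {x : 𝓞 K} (hx : x ≠ 0) : ‖angularChar a x‖ = 1 := by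
  rw [angularChar, norm_zpow, norm_div, norm_real, norm_norm,
    div_self (norm_ne_zero_iff.2 (coe_ne_zero hx)), one_zpow]

lemma heckeChar_mul (a : ℤ) (I J : Ideal (𝓞 K)) :
    heckeChar a (I * J) = heckeChar a I * heckeChar a J := by
  rw [← Ideal.span_singleton_generator I, ← Ideal.span_singleton_generator J,
    Ideal.span_singleton_mul_span_singleton, heckeChar_span, heckeChar_span, heckeChar_span,
    angularChar_mul]

lemma heckeChar_one (a : ℤ) : heckeChar a 1 = 1 := by
  rw [Ideal.one_eq_top, ← Ideal.span_singleton_one, heckeChar_span, angularChar]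
  simp

lemma heckeChar_zero_left (I : Ideal (𝓞 K)) : heckeChar 0 I = 1 := by
  simp [heckeChar, angularChar]

lemma norm_heckeChar (a : ℤ) {I : Ideal (𝓞 K)} (hI : I ≠ ⊥) : ‖heckeChar a I‖ = 1 := by
  refine norm_angularChar a fun h => hI ?_
  rw [← Ideal.span_singleton_generator I, h]
  simp

lemma heckeChar_two_mul (a : ℤ) (I : Ideal (𝓞 K)) : heckeChar (2 * a) I = heckeChar a I ^ 2 := by
  rw [heckeChar, heckeChar, angularChar, angularChar, ← zpow_natCast, ← zpow_mul]
  congr 1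
  push_cast
  ring

lemma absNorm_pos {I : Ideal (𝓞 K)} (hI : I ≠ ⊥) : 0 < Ideal.absNorm I :=
  Nat.pos_of_ne_zero fun h => hI (Ideal.absNorm_eq_zero_iff.1 h)

/-- The term `χ^{6a}(I) / N(I)^s`. -/
noncomputable def heckeFun (a : ℤ) (s : ℂ) (I : Ideal (𝓞 K)) : ℂ :=
  heckeChar a I / (Ideal.absNorm I : ℂ) ^ s

/-- For `s ≠ 0` the conventions `0 ^ s = 0` and `x / 0 = 0` make the zero ideal contribute 0. The
series may thus run over all ideals, with completely multiplicative terms. -/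
lemma exists_monoidWithZeroHom_eq_heckeFun (a : ℤ) {s : ℂ} (hs : s ≠ 0) :
    ∃ g : Ideal (𝓞 K) →*₀ ℂ, heckeFun a s = g :=
  ⟨{ toFun := heckeFun a s
     map_zero' := by simp [heckeFun, hs]
     map_one' := by rw [heckeFun, heckeChar_one]; simp
     map_mul' := fun I J => by
      rw [heckeFun, heckeChar_mul, map_mul, Nat.cast_mul, natCast_mul_natCast_cpow,
        mul_div_mul_comm]; rfl }, rfl⟩

lemma norm_heckeFun (a : ℤ) {s : ℂ} (hs' : s.re ≠ 0) (I : Ideal (𝓞 K)) :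
    ‖heckeFun a s I‖ = (Ideal.absNorm I : ℝ) ^ (-s.re) := by
  have hs : s ≠ 0 := by rintro rfl; simp at hs'
  by_cases hI : I = ⊥
  · subst hI
    simp [heckeFun, Real.zero_rpow (neg_ne_zero.2 hs'), hs]
  · rw [heckeFun, norm_div, norm_heckeChar a hI, norm_natCast_cpow_of_pos (absNorm_pos hI),
      Real.rpow_neg (Nat.cast_nonneg _), one_div]

lemma ne_zero_of_one_lt_re {s : ℂ} (hs : 1 < s.re) : s ≠ 0 := by
  rintro rfl
  norm_num at hs

/-- The sum of the terms `χ^{6a}(I) / N(I)^s` over all ideals. -/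
noncomputable def heckeSum (a : ℤ) (s : ℂ) : ℂ := ∑' I : Ideal (𝓞 K), heckeFun a s I

lemma hasSum_heckeTerm_iff (a : ℤ) {s : ℂ} (hs : s ≠ 0) (z : ℂ) :
    HasSum (heckeTerm a s) z ↔ HasSum (heckeFun a s) z := by
  refine hasSum_subtype_iff_of_support_subset (f := heckeFun a s) (s := {I | I ≠ ⊥}) ?_
  intro I hI h
  rw [h] at hI
  simp [hs, heckeFun] at hI

/-- The Dedekind zeta function of `K` on the real half-line `σ > 1`, as a sum over ideals. -/
noncomputable def zetaSum (σ : ℝ) : ℝ := ∑' I : Ideal (𝓞 K), (Ideal.absNorm I : ℝ) ^ (-σ)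

lemma fiber_absNorm_finite (n : ℕ) : Finite {I : Ideal (𝓞 K) // Ideal.absNorm I = n} :=
  (Ideal.finite_setOfPred_absNorm_eq n).to_subtype

lemma hasSum_fiber_absNorm_rpow (σ : ℝ) (n : ℕ) :
    HasSum (fun I : {I : Ideal (𝓞 K) // Ideal.absNorm I = n} => (Ideal.absNorm I.1 : ℝ) ^ (-σ))
      (Nat.card {I : Ideal (𝓞 K) // Ideal.absNorm I = n} * (n : ℝ) ^ (-σ)) := by
  have := fiber_absNorm_finite n
  let _ : Fintype {I : Ideal (𝓞 K) // Ideal.absNorm I = n} := Fintype.ofFinite _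
  have h := hasSum_fintype
    (fun I : {I : Ideal (𝓞 K) // Ideal.absNorm I = n} => (Ideal.absNorm I.1 : ℝ) ^ (-σ))
  rw [Finset.sum_congr rfl (g := fun _ => (n : ℝ) ^ (-σ)) (fun I _ => by rw [I.2])] at h
  simpa [Nat.card_eq_fintype_card] using h

lemma term_card_absNorm {σ : ℝ} (hσ : σ ≠ 0) (n : ℕ) :
    LSeries.term (fun n ↦ Nat.card {I : Ideal (𝓞 K) // Ideal.absNorm I = n}) (σ : ℂ) n =
      ((Nat.card {I : Ideal (𝓞 K) // Ideal.absNorm I = n} * (n : ℝ) ^ (-σ) : ℝ) : ℂ) := by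
  rcases eq_or_ne n 0 with rfl | hn
  · simp [Real.zero_rpow (neg_ne_zero.2 hσ)]
  · rw [LSeries.term_of_ne_zero hn, ofReal_mul, ofReal_cpow (Nat.cast_nonneg n), div_eq_mul_inv,
      ← cpow_neg]
    push_cast
    rfl

lemma summable_absNorm_rpow_iff {σ : ℝ} (hσ : σ ≠ 0) :
    Summable (fun I : Ideal (𝓞 K) => (Ideal.absNorm I : ℝ) ^ (-σ)) ↔
      LSeriesSummable (fun n ↦ Nat.card {I : Ideal (𝓞 K) // Ideal.absNorm I = n}) (σ : ℂ) := by
  rw [LSeriesSummable, funext (term_card_absNorm hσ), summable_ofReal,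
    ← (Equiv.sigmaFiberEquiv Ideal.absNorm).summable_iff,
    summable_sigma_of_nonneg (fun _ => by simp only [Function.comp]; positivity)]
  refine (and_iff_right fun n => (hasSum_fiber_absNorm_rpow σ n).summable).trans ?_
  refine summable_congr fun n => (hasSum_fiber_absNorm_rpow σ n).tsum_eq

/-- Convergence is read off from the nonzero residue of the Dedekind zeta function at 1: a divergent
series would have the default value 0, yet the zeta function is nonzero at points `s > 1`
arbitrarily close to 1. Comparison with such an `s < σ` finishes. -/
theorem summable_absNorm_rpow {σ : ℝ} (hσ : 1 < σ) :
    Summable (fun I : Ideal (𝓞 K) => (Ideal.absNorm I : ℝ) ^ (-σ)) := by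
  have h1 : ∀ᶠ s : ℝ in 𝓝[>] 1, ((s : ℂ) - 1) * NumberField.dedekindZeta K s ≠ 0 :=
    (NumberField.tendsto_sub_one_mul_dedekindZeta_nhdsGT K).eventually_ne
      (ofReal_ne_zero.2 (NumberField.dedekindZeta_residue_ne_zero K))
  obtain ⟨s, hs, hs1, hsσ⟩ := (h1.and (Ioo_mem_nhdsGT hσ)).exists
  have h2 : LSeriesSummable (fun n ↦ Nat.card {I : Ideal (𝓞 K) // Ideal.absNorm I = n}) (s : ℂ) := by
    by_contra h
    apply hs
    rw [NumberField.dedekindZeta, LSeries, tsum_eq_zero_of_not_summable h, mul_zero]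
  have hs0 : s ≠ 0 := by linarith
  refine ((summable_absNorm_rpow_iff hs0).2 h2).of_nonneg_of_le (fun _ => by positivity)
    fun I => ?_
  rcases Nat.eq_zero_or_pos (Ideal.absNorm I) with h | h
  · rw [h, Nat.cast_zero, Real.zero_rpow (by linarith), Real.zero_rpow (by simpa using hs0)]
  · exact Real.rpow_le_rpow_of_exponent_le (by exact_mod_cast h) (by linarith)

lemma dedekindZeta_eq_zetaSum {σ : ℝ} (hσ : 1 < σ) :
    NumberField.dedekindZeta K σ = zetaSum σ := by
  have h := summable_absNorm_rpow hσ
  have h1 : HasSum (fun n : ℕ => Nat.card {I : Ideal (𝓞 K) // Ideal.absNorm I = n} *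
      (n : ℝ) ^ (-σ)) (zetaSum σ) := by
    have h2 := (Equiv.sigmaFiberEquiv Ideal.absNorm).hasSum_iff.2 h.hasSum
    exact h2.sigma fun n => hasSum_fiber_absNorm_rpow σ n
  rw [NumberField.dedekindZeta, LSeries, funext (term_card_absNorm (by linarith)),
    ← ofReal_tsum, h1.tsum_eq]

theorem tendsto_sub_one_mul_zetaSum :
    ∃ κ : ℝ, 0 < κ ∧ Tendsto (fun σ => (σ - 1) * zetaSum σ) (𝓝[>] 1) (𝓝 κ) := by
  refine ⟨_, NumberField.dedekindZeta_residue_pos K, ?_⟩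
  have h := NumberField.tendsto_sub_one_mul_dedekindZeta_nhdsGT K
  rw [← tendsto_ofReal_iff]
  refine h.congr' ?_
  filter_upwards [self_mem_nhdsWithin] with σ hσ
  rw [dedekindZeta_eq_zetaSum hσ]
  push_cast
  rfl

lemma summable_heckeFun (a : ℤ) {s : ℂ} (hs : 1 < s.re) : Summable fun I => ‖heckeFun a s I‖ := by
  simp_rw [norm_heckeFun a (by linarith : s.re ≠ 0)]
  exact summable_absNorm_rpow hs

lemma hasSum_heckeFun (a : ℤ) {s : ℂ} (hs : 1 < s.re) : HasSum (heckeFun a s) (heckeSum a s) :=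
  (summable_heckeFun a hs).of_norm.hasSum

lemma absNorm_rpow_le_of_le {σ₀ σ : ℝ} (hσ₀ : 1 < σ₀) (h : σ₀ ≤ σ) (I : Ideal (𝓞 K)) :
    (Ideal.absNorm I : ℝ) ^ (-σ) ≤ (Ideal.absNorm I : ℝ) ^ (-σ₀) := by
  rcases Nat.eq_zero_or_pos (Ideal.absNorm I) with h0 | h0
  · rw [h0, Nat.cast_zero, Real.zero_rpow (by linarith), Real.zero_rpow (by linarith)]
  · exact Real.rpow_le_rpow_of_exponent_le (by exact_mod_cast h0) (by linarith)

lemma zetaSum_le_of_le {σ₀ σ : ℝ} (hσ₀ : 1 < σ₀) (h : σ₀ ≤ σ) : zetaSum σ ≤ zetaSum σ₀ :=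
  (summable_absNorm_rpow (hσ₀.trans_le h)).tsum_le_tsum (absNorm_rpow_le_of_le hσ₀ h)
    (summable_absNorm_rpow hσ₀)

lemma zetaSum_pos {σ : ℝ} (hσ : 1 < σ) : 0 < zetaSum σ := by
  refine (summable_absNorm_rpow hσ).tsum_pos (fun _ => by positivity) 1 ?_
  simp

lemma norm_heckeSum_le (a : ℤ) {s : ℂ} (hs : 1 < s.re) : ‖heckeSum a s‖ ≤ zetaSum s.re := by
  refine tsum_of_norm_bounded (summable_absNorm_rpow hs).hasSum fun I => ?_
  rw [norm_heckeFun a (by linarith)]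

lemma heckeFun_zero_ofReal {σ : ℝ} (I : Ideal (𝓞 K)) :
    heckeFun 0 σ I = (((Ideal.absNorm I : ℝ) ^ (-σ) : ℝ) : ℂ) := by
  rw [heckeFun, heckeChar_zero_left, ofReal_cpow (Nat.cast_nonneg _), ofReal_neg, cpow_neg,
    one_div]
  rfl

lemma heckeSum_zero_ofReal (σ : ℝ) : heckeSum 0 σ = zetaSum σ := by
  rw [heckeSum, zetaSum, ofReal_tsum]
  exact tsum_congr fun I => heckeFun_zero_ofReal I

lemma isOpen_one_lt_re : IsOpen {s : ℂ | 1 < s.re} := isOpen_lt continuous_const continuous_re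

lemma hasDerivAt_heckeFun (a : ℤ) {s : ℂ} (hs : s ≠ 0) (I : Ideal (𝓞 K)) :
    HasDerivAt (fun s => heckeFun a s I) (-(Real.log (Ideal.absNorm I) * heckeFun a s I)) s := by
  by_cases hI : I = ⊥
  · subst hI
    have : (fun s => heckeFun a s ⊥) =ᶠ[𝓝 s] fun _ => 0 := by
      filter_upwards [isOpen_ne.mem_nhds hs] with w hw
      simp [heckeFun, hw]
    refine ((hasDerivAt_const s (0 : ℂ)).congr_of_eventuallyEq this).congr_deriv ?_
    simp
  · have hN : (Ideal.absNorm I : ℂ) ≠ 0 := Nat.cast_ne_zero.2 (absNorm_pos hI).ne'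
    have e : (fun s => heckeFun a s I) = fun s => heckeChar a I * (Ideal.absNorm I : ℂ) ^ (-s) := by
      ext s
      rw [heckeFun, cpow_neg, div_eq_mul_inv]
    rw [e]
    refine (((hasDerivAt_neg s).const_cpow (Or.inl hN)).const_mul (heckeChar a I)).congr_deriv ?_
    rw [heckeFun, div_eq_mul_inv, ← cpow_neg, natCast_log]
    ring

lemma differentiableOn_heckeFun (a : ℤ) (I : Ideal (𝓞 K)) {σ : ℝ} (hσ : 0 ≤ σ) :
    DifferentiableOn ℂ (fun s => heckeFun a s I) {s | σ < s.re} := by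
  intro s hs
  have : s ≠ 0 := by rintro rfl; exact absurd hs (by simpa using hσ)
  exact (hasDerivAt_heckeFun a this I).differentiableAt.differentiableWithinAt

lemma norm_heckeFun_le {a : ℤ} {σ : ℝ} (hσ : 1 < σ) (I : Ideal (𝓞 K)) {s : ℂ} (hs : σ < s.re) :
    ‖heckeFun a s I‖ ≤ (Ideal.absNorm I : ℝ) ^ (-σ) := by
  rw [norm_heckeFun a (by linarith)]
  exact absNorm_rpow_le_of_le hσ hs.le I

lemma differentiableOn_heckeSum (a : ℤ) : DifferentiableOn ℂ (heckeSum a) {s | 1 < s.re} := by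
  intro s hs
  obtain ⟨σ, hσ, hσs⟩ := exists_between (show 1 < s.re from hs)
  have ho : IsOpen {s : ℂ | σ < s.re} := isOpen_lt continuous_const continuous_re
  have := differentiableOn_tsum_of_summable_norm (summable_absNorm_rpow hσ)
    (fun I => differentiableOn_heckeFun a I (by linarith : (0 : ℝ) ≤ σ)) ho
    (fun I w hw => norm_heckeFun_le hσ I hw)
  exact (this.differentiableAt (ho.mem_nhds hσs)).differentiableWithinAt

lemma hasSum_deriv_heckeSum (a : ℤ) {s : ℂ} (hs : 1 < s.re) :
    HasSum (fun I : Ideal (𝓞 K) => -(Real.log (Ideal.absNorm I) * heckeFun a s I))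
      (deriv (heckeSum a) s) := by
  obtain ⟨σ, hσ, hσs⟩ := exists_between hs
  have ho : IsOpen {s : ℂ | σ < s.re} := isOpen_lt continuous_const continuous_re
  have := hasSum_deriv_of_summable_norm (summable_absNorm_rpow hσ)
    (fun I => differentiableOn_heckeFun a I (by linarith : (0 : ℝ) ≤ σ)) ho
    (fun I w hw => norm_heckeFun_le hσ I hw) hσs
  simp only [(hasDerivAt_heckeFun a (ne_zero_of_one_lt_re hs) _).deriv] at this
  exact this

end Terms

/-! ### Consequences of the Euler product: nonvanishing, lower bound, the 3-4-1 inequality. -/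

section EulerConsequences

/-- The nonzero prime ideals of `𝓞 K`. -/
abbrev PrimeIdeal := {P : Ideal (𝓞 K) // Prime P}

/-- The partial Euler product of `L(s, χ^{6a})⁻¹`, multiplied by the Dirichlet series. -/
noncomputable def eulerQuotient (a : ℤ) (S : Finset PrimeIdeal) (s : ℂ) : ℂ :=
  heckeSum a s * ∏ P ∈ S, (1 - heckeFun a s P)

lemma tendstoLocallyUniformlyOn_eulerQuotient (a : ℤ) :
    TendstoLocallyUniformlyOn (eulerQuotient a) (fun _ => 1) atTop {s | 1 < s.re} := by
  rw [tendstoLocallyUniformlyOn_iff_forall_isCompact isOpen_one_lt_re]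
  intro C hC hCc
  rcases C.eq_empty_or_nonempty with rfl | hne
  · exact tendstoUniformlyOn_empty
  obtain ⟨s₀, hs₀, hmin⟩ := hCc.exists_isMinOn hne continuous_re.continuousOn
  have h1 : 1 < s₀.re := hC hs₀
  refine tendstoUniformlyOn_tsum_mul_prod_one_sub (f := heckeFun a)
    (summable_absNorm_rpow h1) (fun s hs I => ?_) (fun s hs => ?_)
  · rw [norm_heckeFun a (by have : 1 < s.re := hC hs; linarith)]
    exact absNorm_rpow_le_of_le h1 (hmin hs) I
  · exact exists_monoidWithZeroHom_eq_heckeFun a (ne_zero_of_one_lt_re (hC hs))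

lemma tendsto_eulerQuotient (a : ℤ) {s : ℂ} (hs : 1 < s.re) :
    Tendsto (fun S => eulerQuotient a S s) atTop (𝓝 1) :=
  (tendstoLocallyUniformlyOn_eulerQuotient a).tendsto_at hs

theorem heckeSum_ne_zero (a : ℤ) {s : ℂ} (hs : 1 < s.re) : heckeSum a s ≠ 0 := by
  intro h
  have := tendsto_eulerQuotient a hs
  simp only [eulerQuotient, h, zero_mul] at this
  exact zero_ne_one (tendsto_nhds_unique tendsto_const_nhds this)

lemma two_le_absNorm (P : PrimeIdeal) : 2 ≤ Ideal.absNorm P.1 := by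
  have h0 := absNorm_pos (I := P.1) P.2.ne_zero
  have h1 : Ideal.absNorm P.1 ≠ 1 := fun h =>
    P.2.not_isUnit (Ideal.isUnit_iff.2 (Ideal.absNorm_eq_one_iff.1 h))
  omega

lemma norm_heckeFun_lt_one (a : ℤ) {s : ℂ} (hs : 1 < s.re) (P : PrimeIdeal) :
    ‖heckeFun a s P‖ < 1 := by
  rw [norm_heckeFun a (by linarith)]
  exact Real.rpow_lt_one_of_one_lt_of_neg (by exact_mod_cast two_le_absNorm P) (by linarith)

/-- With `x` the norm of the term at `P`, the pair of Euler factors satisfies `‖1 - heckeFun a s P‖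
* (1 - x) ≤ (1 + x) * (1 - x) ≤ 1`. This gives the lower bound for L at the centre of the disc in
Landau's lemma. -/
theorem one_le_norm_heckeSum_mul_zetaSum (a : ℤ) {s : ℂ} (hs : 1 < s.re) :
    1 ≤ ‖heckeSum a s‖ * zetaSum s.re := by
  have hs' : 1 < ((s.re : ℂ)).re := by simpa using hs
  have h1 := ((tendsto_eulerQuotient a hs).mul (tendsto_eulerQuotient 0 hs')).norm
  rw [mul_one, norm_one] at h1
  refine le_of_tendsto h1 (Eventually.of_forall fun S => ?_)
  rw [eulerQuotient, eulerQuotient, mul_mul_mul_comm, ← Finset.prod_mul_distrib, norm_mul,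
    norm_mul, norm_prod, heckeSum_zero_ofReal, norm_real, Real.norm_of_nonneg (zetaSum_pos hs).le]
  refine mul_le_of_le_one_right (mul_nonneg (norm_nonneg _) (zetaSum_pos hs).le)
    (Finset.prod_le_one (fun _ _ => norm_nonneg _) fun P _ => ?_)
  have hx := norm_heckeFun_lt_one a hs P
  have hP : heckeFun 0 (s.re : ℂ) P = ((‖heckeFun a s P‖ : ℝ) : ℂ) := by
    rw [heckeFun_zero_ofReal, norm_heckeFun a (by linarith)]
  rw [hP, norm_mul]
  set x := ‖heckeFun a s P‖ with hxdef
  have h2 : ‖1 - heckeFun a s P‖ ≤ 1 + x := by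
    simpa using norm_sub_le (1 : ℂ) (heckeFun a s P)
  have h3 : ‖(1 : ℂ) - (x : ℂ)‖ = 1 - x := by
    rw [← ofReal_one, ← ofReal_sub, norm_real, Real.norm_of_nonneg (by linarith)]
  rw [h3]
  have : 0 ≤ x := norm_nonneg _
  nlinarith

/-- The quotients `eulerQuotient a S` tend to 1 locally uniformly, so their derivatives, and hence
their logarithmic derivatives, tend to 0. -/
theorem tendsto_sum_logDeriv (a : ℤ) {s : ℂ} (hs : 1 < s.re) :
    Tendsto (fun S : Finset PrimeIdeal => ∑ P ∈ S,
      (Real.log (Ideal.absNorm P.1) : ℂ) * (heckeFun a s P / (1 - heckeFun a s P))) atTop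
      (𝓝 (-logDeriv (heckeSum a) s)) := by
  have hs0 := ne_zero_of_one_lt_re hs
  have hdF : ∀ P : PrimeIdeal, DifferentiableOn ℂ (fun s => 1 - heckeFun a s P) {s | 1 < s.re} :=
    fun P => (differentiableOn_heckeFun a P.1 zero_le_one).const_sub 1
  have hd : ∀ S, DifferentiableOn ℂ (eulerQuotient a S) {s | 1 < s.re} := fun S =>
    (differentiableOn_heckeSum a).mul (DifferentiableOn.fun_finsetProd fun P _ => hdF P)
  have h1 := ((tendstoLocallyUniformlyOn_eulerQuotient a).deriv (Eventually.of_forall hd)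
    isOpen_one_lt_re).tendsto_at hs
  have h2 := h1.div (tendsto_eulerQuotient a hs) one_ne_zero
  have h3 : Tendsto (fun S : Finset PrimeIdeal => ∑ P ∈ S,
      (Real.log (Ideal.absNorm P.1) : ℂ) * (heckeFun a s P / (1 - heckeFun a s P)) ) atTop
      (𝓝 (0 - logDeriv (heckeSum a) s)) := by
    have h4 := h2.sub_const (logDeriv (heckeSum a) s)
    simp only [Function.comp, deriv_const', zero_div] at h4
    refine h4.congr fun S => ?_
    have hne : ∀ P ∈ S, 1 - heckeFun a s P ≠ 0 := fun P _ h => by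
      have := norm_heckeFun_lt_one a hs P
      rw [← sub_eq_zero.1 h, norm_one] at this
      exact lt_irrefl _ this
    have hdA : ∀ P ∈ S, DifferentiableAt ℂ (fun s => 1 - heckeFun a s P.1) s := fun P _ =>
      (hdF P).differentiableAt (isOpen_one_lt_re.mem_nhds hs)
    have h5 : logDeriv (eulerQuotient a S) s
        = logDeriv (heckeSum a) s + ∑ P ∈ S, logDeriv (fun s => 1 - heckeFun a s P.1) s := by
      rw [← logDeriv_prod hne hdA]
      exact logDeriv_mul (f := heckeSum a) (g := fun s => ∏ P ∈ S, (1 - heckeFun a s P.1)) s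
        (heckeSum_ne_zero a hs) (Finset.prod_ne_zero_iff.2 hne)
        ((differentiableOn_heckeSum a).differentiableAt (isOpen_one_lt_re.mem_nhds hs))
        (DifferentiableAt.fun_finsetProd hdA)
    rw [Pi.div_apply, ← logDeriv_apply (eulerQuotient a S) s, h5, add_sub_cancel_left]
    refine Finset.sum_congr rfl fun P _ => ?_
    rw [logDeriv_apply, ((hasDerivAt_heckeFun a hs0 P.1).const_sub 1).deriv]
    ring
  rwa [zero_sub] at h3

lemma three_four_one_nonneg {x : ℝ} {z : ℂ} (hx0 : 0 ≤ x) (hx : x < 1) (hz : ‖z‖ = 1) :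
    0 ≤ (3 * ((x : ℂ) / (1 - x)) + 4 * (x * z / (1 - x * z)) + x * z ^ 2 / (1 - x * z ^ 2)).re := by
  have hg : ∀ w : ℂ, ‖w‖ = 1 → HasSum (fun n : ℕ => (x * w) ^ (n + 1)) (x * w / (1 - x * w)) := by
    intro w hw
    have := (hasSum_geometric_of_norm_lt_one (ξ := (x * w : ℂ))
      (by rw [norm_mul, hw, mul_one, norm_real, Real.norm_of_nonneg hx0]; exact hx)).mul_left
      (x * w : ℂ)
    simpa only [← pow_succ', ← div_eq_mul_inv] using this
  have h1 := hg 1 norm_one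
  have h := ((h1.mul_left 3).add ((hg z hz).mul_left 4)).add
    (hg (z ^ 2) (by rw [norm_pow, hz, one_pow]))
  rw [mul_one] at h
  refine (hasSum_re h).nonneg fun n => ?_
  set w := z ^ (n + 1) with hw
  have hwn : w.re ^ 2 + w.im ^ 2 = 1 := by
    have : normSq w = 1 := by rw [normSq_eq_norm_sq, hw, norm_pow, hz]; simp
    rw [← this, normSq_apply]; ring
  have e : 3 * (x : ℂ) ^ (n + 1) + 4 * (x * z) ^ (n + 1) + (x * z ^ 2) ^ (n + 1)
      = ((x ^ (n + 1) : ℝ) : ℂ) * (3 + 4 * w + w ^ 2) := by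
    rw [hw]; push_cast; ring
  rw [e, re_ofReal_mul]
  refine mul_nonneg (by positivity) ?_
  simp only [add_re, mul_re, pow_two, re_ofNat, im_ofNat]
  -- On the unit circle `Re (3 + 4w + w²) = 2 (1 + Re w)²`.
  nlinarith [sq_nonneg (w.re + 1)]

theorem three_four_one (a : ℤ) {σ : ℝ} (hσ : 1 < σ) (t : ℝ) :
    3 * (logDeriv (heckeSum 0) σ).re + 4 * (logDeriv (heckeSum a) (σ + t * I)).re
      + (logDeriv (heckeSum (2 * a)) (σ + (2 * t : ℝ) * I)).re ≤ 0 := by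
  have h0 := tendsto_sum_logDeriv 0 (s := σ) (by simpa using hσ)
  have h1 := tendsto_sum_logDeriv a (s := σ + t * I) (by simpa using hσ)
  have h2 := tendsto_sum_logDeriv (2 * a) (s := σ + (2 * t : ℝ) * I) (by simpa using hσ)
  have h := (continuous_re.tendsto _).comp (((h0.const_mul 3).add (h1.const_mul 4)).add h2)
  have hnn := ge_of_tendsto (b := 0) h ?_
  · have e : (3 * -logDeriv (heckeSum 0) σ + 4 * -logDeriv (heckeSum a) (σ + t * I)
      + -logDeriv (heckeSum (2 * a)) (σ + (2 * t : ℝ) * I)).re =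
      -(3 * (logDeriv (heckeSum 0) σ).re + 4 * (logDeriv (heckeSum a) (σ + t * I)).re
      + (logDeriv (heckeSum (2 * a)) (σ + (2 * t : ℝ) * I)).re) := by
      simp only [add_re, mul_re, neg_re, re_ofNat, im_ofNat]
      ring
    rw [e] at hnn
    exact neg_nonneg.1 hnn
  · refine Eventually.of_forall fun S => ?_
    simp only [Function.comp]
    rw [Finset.mul_sum, Finset.mul_sum, ← Finset.sum_add_distrib, ← Finset.sum_add_distrib, re_sum]
    refine Finset.sum_nonneg fun P _ => ?_
    have hN : (Ideal.absNorm P.1 : ℂ) ≠ 0 :=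
      Nat.cast_ne_zero.2 (absNorm_pos (I := P.1) P.2.ne_zero).ne'
    set x : ℝ := (Ideal.absNorm P.1 : ℝ) ^ (-σ) with hx
    set z : ℂ := heckeChar a P.1 * (Ideal.absNorm P.1 : ℂ) ^ (-(t * I)) with hz
    have e0 : heckeFun 0 σ P.1 = x := heckeFun_zero_ofReal P.1
    have hxc : (x : ℂ) = (Ideal.absNorm P.1 : ℂ) ^ (-σ : ℂ) := by
      rw [hx, ofReal_cpow (Nat.cast_nonneg _)]; push_cast; rfl
    have e1 : heckeFun a (σ + t * I) P.1 = x * z := by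
      rw [heckeFun, hxc, hz, div_eq_mul_inv, ← cpow_neg, neg_add, cpow_add _ _ hN]
      ring
    have e2 : heckeFun (2 * a) (σ + (2 * t : ℝ) * I) P.1 = x * z ^ 2 := by
      rw [heckeFun, hxc, hz, div_eq_mul_inv, ← cpow_neg, neg_add, cpow_add _ _ hN,
        heckeChar_two_mul, mul_pow, ← cpow_nat_mul]
      push_cast
      ring_nf
    have hz1 : ‖z‖ = 1 := by
      rw [hz, norm_mul, norm_heckeChar a P.2.ne_zero, one_mul,
        norm_natCast_cpow_of_pos (absNorm_pos (I := P.1) P.2.ne_zero)]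
      simp
    have hx1 : x < 1 := by
      have := norm_heckeFun_lt_one 0 (s := σ) (by simpa using hσ) P
      rwa [e0, norm_real, Real.norm_of_nonneg (by positivity)] at this
    have := three_four_one_nonneg (by positivity : 0 ≤ x) hx1 hz1
    rw [e0, e1, e2]
    have e : ∀ l u v w : ℂ, 3 * (l * u) + 4 * (l * v) + l * w = l * (3 * u + 4 * v + w) := by
      intros; ring
    rw [e, re_ofReal_mul]
    exact mul_nonneg (Real.log_natCast_nonneg _) this

end EulerConsequences

/-! ### The logarithmic derivative of the Dedekind zeta function near 1. -/

section ZetaLogDeriv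

/-- Convexity of zeta on the real axis: termwise this is `y ≤ exp y - 1` with `y = δ log N(I)`. -/
lemma mul_neg_deriv_le {σ δ : ℝ} (hδ : 0 ≤ δ) (h : 1 < σ - δ) :
    δ * -(deriv (heckeSum 0) σ).re ≤ zetaSum (σ - δ) - zetaSum σ := by
  have hσ : 1 < σ := by linarith
  have h1 := (hasSum_re (hasSum_deriv_heckeSum 0 (s := σ) (by simpa using hσ))).neg.mul_left δ
  have h2 := (summable_absNorm_rpow h).hasSum.sub (summable_absNorm_rpow hσ).hasSum
  refine hasSum_le (fun I => ?_) h1 h2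
  rw [heckeFun_zero_ofReal, ← ofReal_mul, ← ofReal_neg, ofReal_re, neg_neg]
  rcases Nat.eq_zero_or_pos (Ideal.absNorm I) with h0 | h0
  · rw [h0, Nat.cast_zero, Real.zero_rpow (by linarith), Real.zero_rpow (by linarith)]
    simp
  · have hN : (0 : ℝ) < Ideal.absNorm I := by exact_mod_cast h0
    have e : (Ideal.absNorm I : ℝ) ^ (-(σ - δ))
        = (Ideal.absNorm I : ℝ) ^ (-σ) * Real.exp (Real.log (Ideal.absNorm I) * δ) := by
      rw [← Real.rpow_def_of_pos hN, ← Real.rpow_add hN]; ring_nf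
    rw [e]
    have h3 := Real.add_one_le_exp (Real.log (Ideal.absNorm I) * δ)
    have h4 : 0 ≤ (Ideal.absNorm I : ℝ) ^ (-σ) := by positivity
    nlinarith

/-- Convexity replaces information on the derivative, so the limit of `(σ - 1) * zetaSum σ`
suffices. Any constant below `40/33` in place of `11/10` would leave room in the final comparison `4
* 10/11 > 3 * 11/10`. -/
theorem exists_neg_logDeriv_zeta_le :
    ∃ η₀ > 0, ∀ η, 0 < η → η ≤ η₀ →
      -(logDeriv (heckeSum 0) ((1 + η : ℝ) : ℂ)).re ≤ (11 / 10) / η := by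
  obtain ⟨κ, hκ, hlim⟩ := tendsto_sub_one_mul_zetaSum
  have h1 : ∀ᶠ σ in 𝓝[>] (1 : ℝ), κ * (999 / 1000) < (σ - 1) * zetaSum σ :=
    hlim.eventually (lt_mem_nhds (by linarith))
  have h2 : ∀ᶠ σ in 𝓝[>] (1 : ℝ), (σ - 1) * zetaSum σ < κ * (1001 / 1000) :=
    hlim.eventually (gt_mem_nhds (by linarith))
  obtain ⟨c, hc, hcs⟩ := mem_nhdsGT_iff_exists_Ioc_subset.1 (h1.and h2)
  refine ⟨c - 1, sub_pos.2 hc, fun η hη hηc => ?_⟩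
  have hA := hcs (show 1 + η ∈ Set.Ioc 1 c from ⟨by linarith, by linarith⟩)
  have hB := hcs (show 1 + η - η / 20 ∈ Set.Ioc 1 c from ⟨by linarith, by linarith⟩)
  -- With step `η / 20` and relative error `1/1000` in the limit, the constant is `20 * (20/19 *
  -- 1001/999 - 1) < 11/10`.
  have h3 := mul_neg_deriv_le (σ := 1 + η) (δ := η / 20) (by linarith) (by linarith)
  set Z := zetaSum (1 + η)
  set Z' := zetaSum (1 + η - η / 20)
  have hA1 : κ * (999 / 1000) < η * Z := by have := hA.1; simpa using this
  have hB2 : (η * (19 / 20)) * Z' < κ * (1001 / 1000) := by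
    have := hB.2
    have e : 1 + η - η / 20 - 1 = η * (19 / 20) := by ring
    rwa [e] at this
  have hZ : 0 < Z := zetaSum_pos (by linarith)
  rw [logDeriv_apply, heckeSum_zero_ofReal, div_ofReal_re, ← neg_div, div_le_div_iff₀ hZ hη]
  nlinarith

end ZetaLogDeriv
-- The ring of integers as a hexagonal lattice.
section Lattice

lemma zetaThree_mem : zetaThree ∈ K := by
  rw [K_eq_adjoin_zetaThree]
  exact IntermediateField.mem_adjoin_simple_self ℚ zetaThree

lemma isPrimitiveRoot_zetaThree_K : IsPrimitiveRoot (⟨zetaThree, zetaThree_mem⟩ : K) 3 :=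
  IsPrimitiveRoot.of_map_of_injective (f := K.val) isPrimitiveRoot_zetaThree
    K.val.injective

/-- The primitive cube root of unity `(-1 + √-3) / 2` in `𝓞 K`. -/
noncomputable def omega : 𝓞 K := isPrimitiveRoot_zetaThree_K.toInteger

lemma coe_omega : ((omega : K) : ℂ) = zetaThree := rfl

lemma zetaThree_sq : zetaThree ^ 2 = -1 - zetaThree := by
  rw [zetaThree]
  linear_combination sqrtNegThree_sq / 4

lemma coe_injective : Function.Injective fun x : 𝓞 K => ((x : K) : ℂ) := fun x y h => by
  simpa using h

lemma omega_sq : omega ^ 2 = -1 - omega := by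
  apply coe_injective
  have := zetaThree_sq
  rw [← coe_omega] at this
  simpa using this

lemma exists_eq_add_mul_omega (x : 𝓞 K) : ∃ m n : ℤ, x = m + n * omega := by
  have hx : x ∈ Algebra.adjoin ℤ {omega} := by
    have : Algebra.adjoin ℤ ({omega} : Set (𝓞 K)) = ⊤ :=
      IsCyclotomicExtension.Rat.adjoin_singleton_eq_top isPrimitiveRoot_zetaThree_K
    rw [this]; trivial
  induction hx using Algebra.adjoin_induction with
  | mem x hx =>
    rw [Set.mem_singleton_iff] at hx
    exact ⟨0, 1, by simp [hx]⟩
  | algebraMap r => exact ⟨r, 0, by simp⟩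
  | add x y _ _ hx hy =>
    obtain ⟨m, n, rfl⟩ := hx
    obtain ⟨m', n', rfl⟩ := hy
    exact ⟨m + m', n + n', by push_cast; ring⟩
  | mul x y _ _ hx hy =>
    obtain ⟨m, n, rfl⟩ := hx
    obtain ⟨m', n', rfl⟩ := hy
    refine ⟨m * m' - n * n', m * n' + n * m' - n * n', ?_⟩
    push_cast
    linear_combination (n * n' : 𝓞 K) * omega_sq

lemma sqrtNegThree_re : sqrtNegThree.re = 0 := by simp [sqrtNegThree]
lemma sqrtNegThree_im : sqrtNegThree.im = Real.sqrt 3 := by simp [sqrtNegThree]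

lemma coe_add_mul_omega (m n : ℤ) :
    (((m + n * omega : 𝓞 K) : K) : ℂ) = (((2 * m - n : ℤ) : ℂ) + (n : ℂ) * sqrtNegThree) / 2 := by
  have h : ∀ k : ℤ, (((k : 𝓞 K) : K) : ℂ) = k := fun k => by simp
  simp only [map_add, map_mul, MulMemClass.coe_mul, AddMemClass.coe_add]
  push_cast
  rw [coe_omega, zetaThree, h, h]
  ring

lemma halfLattice_injective {p q p' q' : ℤ}
    (h : ((p : ℂ) + q * sqrtNegThree) / 2 = ((p' : ℂ) + q' * sqrtNegThree) / 2) :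
    p = p' ∧ q = q' := by
  have h' : (p : ℂ) + q * sqrtNegThree = (p' : ℂ) + q' * sqrtNegThree := by
    linear_combination 2 * h
  have hre := congrArg re h'
  have him := congrArg im h'
  simp [sqrtNegThree_re, sqrtNegThree_im] at hre him
  exact ⟨by exact_mod_cast hre, by exact_mod_cast him⟩

/-- The coordinates `(m, n)` of the element `m + n ω` of `𝓞 K`. -/
noncomputable def coordEquiv : ℤ × ℤ ≃ 𝓞 K :=
  Equiv.ofBijective (fun v => (v.1 : 𝓞 K) + v.2 * omega) <| by
    constructor
    · rintro ⟨m, n⟩ ⟨m', n'⟩ h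
      have h1 := congrArg (fun x : 𝓞 K => ((x : K) : ℂ)) h
      simp only [coe_add_mul_omega] at h1
      have := halfLattice_injective h1
      ext <;> simp only <;> omega
    · intro x
      obtain ⟨m, n, h⟩ := exists_eq_add_mul_omega x
      exact ⟨(m, n), h.symm⟩

lemma coe_coordEquiv (v : ℤ × ℤ) : (((coordEquiv v : 𝓞 K) : K) : ℂ) =
    (((2 * v.1 - v.2 : ℤ) : ℂ) + (v.2 : ℂ) * sqrtNegThree) / 2 :=
  coe_add_mul_omega v.1 v.2

instance : Countable (𝓞 K) := coordEquiv.symm.injective.countable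

lemma norm_sq_halfLattice (p q : ℤ) :
    ‖((p : ℂ) + q * sqrtNegThree) / 2‖ ^ 2 = ((p : ℝ) ^ 2 + 3 * (q : ℝ) ^ 2) / 4 := by
  rw [← normSq_eq_norm_sq, normSq_apply]
  have h3 : Real.sqrt 3 * Real.sqrt 3 = 3 := Real.mul_self_sqrt (by norm_num)
  simp [sqrtNegThree_re, sqrtNegThree_im]
  linear_combination (q : ℝ) ^ 2 / 4 * h3

lemma norm_sq_coordEquiv (v : ℤ × ℤ) : ‖(((coordEquiv v : 𝓞 K) : K) : ℂ)‖ ^ 2 =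
    (v.1 : ℝ) ^ 2 - v.1 * v.2 + (v.2 : ℝ) ^ 2 := by
  rw [coe_coordEquiv, norm_sq_halfLattice]
  push_cast
  ring

/-- In the coordinates `p = 2m - n`, `q = n` the norm form becomes the diagonal form `(p² + 3q²) /
4`, at the price of the parity condition on `p + q`. -/
lemma hasSum_coe_iff (G : ℂ → ℂ) (S : ℂ) :
    HasSum (fun x : 𝓞 K => G ((x : K) : ℂ)) S ↔ HasSum (fun v : ℤ × ℤ =>
      if Even (v.1 + v.2) then G (((v.1 : ℂ) + v.2 * sqrtNegThree) / 2) else 0) S := by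
  have hj : Function.Injective (fun v : ℤ × ℤ => ((2 * v.1 - v.2, v.2) : ℤ × ℤ)) := by
    rintro ⟨m, n⟩ ⟨m', n'⟩ h
    simp only [Prod.mk.injEq] at h ⊢
    omega
  rw [← coordEquiv.hasSum_iff]
  refine Iff.trans ?_ (hj.hasSum_iff ?_)
  · refine iff_of_eq (congrArg (HasSum · S) (funext fun v => ?_))
    simp only [Function.comp, coe_coordEquiv]
    rw [if_pos (show Even (2 * v.1 - v.2 + v.2) from ⟨v.1, by ring⟩)]
  · rintro ⟨p, q⟩ h
    refine if_neg ?_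
    rintro ⟨r, hr⟩
    refine h ⟨(r, q), ?_⟩
    simp only at hr
    simp only [Prod.mk.injEq, and_true]
    omega

/-- The field has a single infinite place, which is complex and so counts with multiplicity 2 in the
product formula for the norm. -/
theorem norm_sq_eq_absNorm (x : 𝓞 K) :
    ‖((x : K) : ℂ)‖ ^ 2 = (Ideal.absNorm (Ideal.span {x}) : ℝ) := by
  have hcard : Fintype.card (NumberField.InfinitePlace K) = 1 := by
    rw [NumberField.InfinitePlace.card_eq_nrRealPlaces_add_nrComplexPlaces,
      IsCyclotomicExtension.Rat.nrRealPlaces_eq_zero (n := 3) K (by decide),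
      IsCyclotomicExtension.Rat.nrComplexPlaces_eq_totient_div_two (n := 3)]
    rfl
  have hu := Fintype.card_le_one_iff_subsingleton.1 hcard.le
  have hT : NumberField.IsTotallyComplex K :=
    IsCyclotomicExtension.Rat.isTotallyComplex (n := 3) K (by decide)
  set w : NumberField.InfinitePlace K := NumberField.InfinitePlace.mk (K.val : K →+* ℂ) with hw
  have h := NumberField.InfinitePlace.prod_eq_abs_norm (x : K)
  rw [Fintype.prod_subsingleton _ w] at h
  have hm : w.mult = 2 := NumberField.InfinitePlace.mult_isComplex ⟨w, hT.isComplex w⟩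
  rw [hm, hw, NumberField.InfinitePlace.apply] at h
  rw [Ideal.absNorm_span_singleton, Nat.cast_natAbs]
  refine h.trans ?_
  rw [← Algebra.coe_norm_int]
  push_cast
  rfl

lemma one_le_norm_coe {x : 𝓞 K} (hx : x ≠ 0) : 1 ≤ ‖((x : K) : ℂ)‖ := by
  have h := norm_sq_eq_absNorm x
  have h1 : 1 ≤ Ideal.absNorm (Ideal.span {x}) := absNorm_pos (by simpa using hx)
  have h2 : (1 : ℝ) ≤ ‖((x : K) : ℂ)‖ ^ 2 := by rw [h]; exact_mod_cast h1
  exact (one_le_sq_iff₀ (norm_nonneg _)).1 h2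

end Lattice
-- The generating theta function and its inversion formula.
section Theta

open Real in
/-- The Gaussian with a linear exponential, `exp (-π α |z|² + 2 π i w z)`. -/
noncomputable def gaussKernel (α : ℝ) (w z : ℂ) : ℂ :=
  cexp (-(π * α * ‖z‖ ^ 2 : ℝ) + 2 * π * I * w * z)

lemma norm_gaussKernel_le (α : ℝ) (w z : ℂ) : ‖gaussKernel α w z‖
    ≤ Real.exp (-(Real.pi * α * ‖z‖ ^ 2) + 2 * Real.pi * ‖w‖ * ‖z‖) := by
  rw [gaussKernel, norm_exp, Real.exp_le_exp, add_re, ← ofReal_neg, ofReal_re]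
  have : (2 * Real.pi * I * w * z).re ≤ ‖2 * Real.pi * I * w * z‖ := re_le_norm _
  simp only [norm_mul, norm_real, norm_I, mul_one, norm_ofNat, Real.norm_of_nonneg Real.pi_pos.le]
    at this
  linarith

lemma summable_exp_neg_norm_sq {α : ℝ} (hα : 0 < α) (r : ℝ) (hr : 0 ≤ r) :
    Summable fun x : 𝓞 K => Real.exp (-(Real.pi * α * ‖((x : K) : ℂ)‖ ^ 2)
      + 2 * Real.pi * r * ‖((x : K) : ℂ)‖) := by
  have h1 := summable_pow_mul_jacobiTheta₂_term_bound r (by positivity : 0 < α / 2) 0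
  simp only [pow_zero, one_mul] at h1
  have h2 := h1.mul_of_nonneg h1 (fun _ => (Real.exp_pos _).le) (fun _ => (Real.exp_pos _).le)
  rw [← coordEquiv.summable_iff]
  refine h2.of_nonneg_of_le (fun _ => (Real.exp_pos _).le) fun v => ?_
  simp only [Function.comp]
  rw [← Real.exp_add, Real.exp_le_exp, norm_sq_coordEquiv]
  have hn : ‖(((coordEquiv v : 𝓞 K) : K) : ℂ)‖ ≤ |(v.1 : ℝ)| + |(v.2 : ℝ)| := by
    rw [← sq_le_sq₀ (norm_nonneg _) (by positivity), norm_sq_coordEquiv, add_sq, sq_abs, sq_abs,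
      mul_assoc, ← abs_mul]
    have h3 := neg_abs_le ((v.1 : ℝ) * v.2)
    have h4 := abs_nonneg ((v.1 : ℝ) * v.2)
    linarith
  have hπ := Real.pi_pos
  have h5 : 2 * Real.pi * r * ‖(((coordEquiv v : 𝓞 K) : K) : ℂ)‖
      ≤ 2 * Real.pi * r * (|(v.1 : ℝ)| + |(v.2 : ℝ)|) := by gcongr
  have h6 : 0 ≤ Real.pi * α * ((v.1 : ℝ) - v.2) ^ 2 := by positivity
  push_cast
  nlinarith

lemma summable_gaussKernel {α : ℝ} (hα : 0 < α) (w : ℂ) :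
    Summable fun x : 𝓞 K => gaussKernel α w ((x : K) : ℂ) :=
  (summable_exp_neg_norm_sq hα ‖w‖ (norm_nonneg _)).of_norm_bounded
    fun _ => norm_gaussKernel_le _ _ _

/-- The generating function of the theta series of `𝓞 K` with harmonic coefficients. -/
noncomputable def thetaGen (α : ℝ) (w : ℂ) : ℂ :=
  ∑' x : 𝓞 K, gaussKernel α w ((x : K) : ℂ)

lemma gaussKernel_halfLattice (α : ℝ) (w : ℂ) (p q : ℤ) :
    gaussKernel α w (((p : ℂ) + q * sqrtNegThree) / 2) =
      jacobiTheta₂_term p (w / 2) ((α / 4 : ℝ) * I) *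
      jacobiTheta₂_term q (sqrtNegThree * w / 2) ((3 * α / 4 : ℝ) * I) := by
  rw [gaussKernel, norm_sq_halfLattice, jacobiTheta₂_term, jacobiTheta₂_term, ← exp_add]
  congr 1
  push_cast
  linear_combination (-(Real.pi * α * p ^ 2 / 4) - Real.pi * 3 * α * q ^ 2 / 4) * I_sq

lemma jacobiTheta₂_term_add_half (n : ℤ) (z τ : ℂ) :
    jacobiTheta₂_term n (z + 1 / 2) τ = (-1) ^ n * jacobiTheta₂_term n z τ := by
  rw [jacobiTheta₂_term, jacobiTheta₂_term, ← exp_pi_mul_I, ← exp_int_mul, ← exp_add]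
  congr 1
  ring

lemma ofReal_mul_I_im_pos {β : ℝ} (hβ : 0 < β) : 0 < ((β : ℂ) * I).im := by simpa using hβ

lemma hasSum_mul_of_hasSum {ι κ : Type*} {f : ι → ℂ} {g : κ → ℂ} {a b : ℂ} (hf : HasSum f a)
    (hg : HasSum g b) : HasSum (fun v : ι × κ => f v.1 * g v.2) (a * b) :=
  hf.mul hg (summable_mul_of_summable_norm hf.summable.norm hg.summable.norm)

lemma hasSum_jacobiTheta₂_mul {β γ : ℝ} (hβ : 0 < β) (hγ : 0 < γ) (z z' : ℂ) :
    HasSum (fun v : ℤ × ℤ => jacobiTheta₂_term v.1 z (β * I) * jacobiTheta₂_term v.2 z' (γ * I))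
      (jacobiTheta₂ z (β * I) * jacobiTheta₂ z' (γ * I)) :=
  hasSum_mul_of_hasSum (f := fun n => jacobiTheta₂_term n z (β * I))
    (g := fun n => jacobiTheta₂_term n z' (γ * I))
    (hasSum_jacobiTheta₂_term z (ofReal_mul_I_im_pos hβ))
    (hasSum_jacobiTheta₂_term z' (ofReal_mul_I_im_pos hγ))

/-- The diagonal form splits each term into a product. The parity condition is imposed by `(1 + (-1)
^ (p + q)) / 2`, and shifting both arguments by `1/2` inserts the sign. -/
lemma thetaGen_eq_jacobi {α : ℝ} (hα : 0 < α) (w : ℂ) :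
    thetaGen α w = (jacobiTheta₂ (w / 2) ((α / 4 : ℝ) * I) *
        jacobiTheta₂ (sqrtNegThree * w / 2) ((3 * α / 4 : ℝ) * I) +
      jacobiTheta₂ (w / 2 + 1 / 2) ((α / 4 : ℝ) * I) *
        jacobiTheta₂ (sqrtNegThree * w / 2 + 1 / 2) ((3 * α / 4 : ℝ) * I)) / 2 := by
  refine ((hasSum_coe_iff (gaussKernel α w) _).1 (summable_gaussKernel hα w).hasSum).unique ?_
  have h1 := hasSum_jacobiTheta₂_mul (by positivity : 0 < α / 4) (by positivity : 0 < 3 * α / 4)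
    (w / 2) (sqrtNegThree * w / 2)
  have h2 := hasSum_jacobiTheta₂_mul (by positivity : 0 < α / 4) (by positivity : 0 < 3 * α / 4)
    (w / 2 + 1 / 2) (sqrtNegThree * w / 2 + 1 / 2)
  refine ((h1.add h2).div_const 2).congr_fun fun v => ?_
  rw [jacobiTheta₂_term_add_half, jacobiTheta₂_term_add_half, gaussKernel_halfLattice]
  rcases Int.even_or_odd (v.1 + v.2) with h | h
  · have e : (-1 : ℂ) ^ v.1 * (-1) ^ v.2 = 1 := by
      rw [← zpow_add₀ (by norm_num), h.neg_one_zpow]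
    rw [if_pos h]
    linear_combination (-(jacobiTheta₂_term v.1 (w / 2) ((α / 4 : ℝ) * I) *
      jacobiTheta₂_term v.2 (sqrtNegThree * w / 2) ((3 * α / 4 : ℝ) * I)) / 2) * e
  · have e : (-1 : ℂ) ^ v.1 * (-1) ^ v.2 = -1 := by
      rw [← zpow_add₀ (by norm_num), h.neg_one_zpow]
    rw [if_neg (Int.not_even_iff_odd.2 h)]
    linear_combination (-(jacobiTheta₂_term v.1 (w / 2) ((α / 4 : ℝ) * I) *
      jacobiTheta₂_term v.2 (sqrtNegThree * w / 2) ((3 * α / 4 : ℝ) * I)) / 2) * e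

lemma exp_mul_jacobiTheta₂_term {β : ℝ} (hβ : 0 < β) (n : ℤ) (z : ℂ) :
    cexp (-Real.pi * I * z ^ 2 / (β * I)) * jacobiTheta₂_term n (z / (β * I)) (-1 / (β * I)) =
      cexp (-Real.pi / β * (n - z) ^ 2) := by
  have hβ' : (β : ℂ) ≠ 0 := ofReal_ne_zero.2 hβ.ne'
  rw [jacobiTheta₂_term, ← exp_add]
  congr 1
  field_simp
  ring

/-- Jacobi's functional equation, with the exponential prefactor absorbed by completing the square.
-/
lemma hasSum_jacobiTheta₂_poisson {β : ℝ} (hβ : 0 < β) (z : ℂ) :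
    HasSum (fun n : ℤ => cexp (-Real.pi / β * (n - z) ^ 2))
      ((Real.sqrt β : ℂ) * jacobiTheta₂ z (β * I)) := by
  have hτ : 0 < (-1 / ((β : ℂ) * I)).im := by
    have : -1 / ((β : ℂ) * I) = ((β⁻¹ : ℝ) : ℂ) * I := by
      have hβ' : (β : ℂ) ≠ 0 := ofReal_ne_zero.2 hβ.ne'
      push_cast
      field_simp
      rw [I_sq]
    rw [this]
    exact ofReal_mul_I_im_pos (inv_pos.2 hβ)
  have h := (hasSum_jacobiTheta₂_term (z / (β * I)) hτ).mul_left
    (cexp (-Real.pi * I * z ^ 2 / (β * I)))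
  simp only [exp_mul_jacobiTheta₂_term hβ] at h
  convert! h using 1
  have e : (-I * (β * I)) ^ (1 / 2 : ℂ) = (Real.sqrt β : ℂ) := by
    have : -I * (β * I) = (β : ℂ) := by linear_combination (-β : ℂ) * I_sq
    rw [this, Real.sqrt_eq_rpow, ofReal_cpow hβ.le]
    norm_num
  have hs : (Real.sqrt β : ℂ) ≠ 0 := ofReal_ne_zero.2 (Real.sqrt_pos.2 hβ).ne'
  rw [jacobiTheta₂_functional_equation, e]
  field_simp

/-- The two `w²` terms cancel because `(w/2)² + (√-3 w/2)² / 3 = 0`, so the kernel keeps its form;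
this reflects the harmonicity of `z ^ k`. The swap `(m, n) ↦ (2n, -2m)` comes from pulling `√-3` out
of the linear term: `3m + n√-3 = √-3 (n - m√-3)`. -/
lemma exp_mul_exp_eq_gaussKernel {α : ℝ} (hα : 0 < α) (w : ℂ) (m n : ℝ) (p q : ℤ)
    (hp : (p : ℝ) = 2 * n) (hq : (q : ℝ) = -(2 * m)) :
    cexp (-Real.pi / (α / 4 : ℝ) * (m - w / 2) ^ 2) *
      cexp (-Real.pi / (3 * α / 4 : ℝ) * (n - sqrtNegThree * w / 2) ^ 2) =
    gaussKernel (4 / (3 * α)) (2 / (Real.sqrt 3 * α) * w) (((p : ℂ) + q * sqrtNegThree) / 2) := by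
  have hα' : (α : ℂ) ≠ 0 := ofReal_ne_zero.2 hα.ne'
  have h3 : (Real.sqrt 3 : ℂ) ^ 2 = 3 := by
    rw [← ofReal_pow, Real.sq_sqrt (by norm_num)]; norm_num
  have h3' : (Real.sqrt 3 : ℂ) ≠ 0 := by rintro h; rw [h] at h3; norm_num at h3
  have hp' : (p : ℂ) = 2 * n := by exact_mod_cast congrArg ofReal hp
  have hq' : (q : ℂ) = -(2 * m) := by exact_mod_cast congrArg ofReal hq
  rw [gaussKernel, norm_sq_halfLattice, ← exp_add, hp, hq, hp', hq', sqrtNegThree]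
  congr 1
  have e : 2 / ((Real.sqrt 3 : ℂ) * α) = 2 * Real.sqrt 3 / (3 * α) := by
    rw [div_eq_div_iff (mul_ne_zero h3' hα') (mul_ne_zero (by norm_num) hα')]
    linear_combination (-2 * α : ℂ) * h3
  rw [e]
  push_cast
  linear_combination ((-(Real.pi * w ^ 2 / α) + 4 * Real.pi * m * w / α) / 3 : ℂ) *
    (I ^ 2 * h3 + 3 * I_sq)

/-- Pairs with even sum are both even or both odd. After Poisson summation the unshifted Jacobi
product yields the first kind and the half-shifted product the second. -/
lemma hasSum_even_add_odd {G : ℤ × ℤ → ℂ} {A B : ℂ}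
    (hA : HasSum (fun v : ℤ × ℤ => G (2 * v.2, -(2 * v.1))) A)
    (hB : HasSum (fun v : ℤ × ℤ => G (2 * v.2 - 1, -(2 * v.1 - 1))) B) :
    HasSum (fun v : ℤ × ℤ => if Even (v.1 + v.2) then G v else 0) (A + B) := by
  have hi : Function.Injective (fun v : ℤ × ℤ => ((2 * v.2, -(2 * v.1)) : ℤ × ℤ)) := by
    rintro ⟨m, n⟩ ⟨m', n'⟩ h
    simp only [Prod.mk.injEq] at h ⊢
    omega
  have hj : Function.Injective (fun v : ℤ × ℤ => ((2 * v.2 - 1, -(2 * v.1 - 1)) : ℤ × ℤ)) := by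
    rintro ⟨m, n⟩ ⟨m', n'⟩ h
    simp only [Prod.mk.injEq] at h ⊢
    omega
  have hA' : HasSum (fun v : ℤ × ℤ => if Even v.1 ∧ Even v.2 then G v else 0) A := by
    refine (hi.hasSum_iff ?_).1 (hA.congr_fun fun v => ?_)
    · rintro ⟨p, q⟩ h
      refine if_neg ?_
      rintro ⟨⟨r, hr⟩, ⟨s, hs⟩⟩
      refine h ⟨(-s, r), ?_⟩
      simp only [Prod.mk.injEq] at hr hs ⊢
      omega
    · simp only [Function.comp]
      rw [if_pos ⟨even_two_mul _, (even_two_mul _).neg⟩]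
  have hB' : HasSum (fun v : ℤ × ℤ => if ¬ Even v.1 ∧ ¬ Even v.2 then G v else 0) B := by
    refine (hj.hasSum_iff ?_).1 (hB.congr_fun fun v => ?_)
    · rintro ⟨p, q⟩ h
      refine if_neg ?_
      simp only [Int.not_even_iff_odd]
      rintro ⟨⟨r, hr⟩, ⟨s, hs⟩⟩
      refine h ⟨(-s, r + 1), ?_⟩
      simp only [Prod.mk.injEq] at hr hs ⊢
      omega
    · simp only [Function.comp]
      rw [if_pos]
      simp [parity_simps]
  refine (hA'.add hB').congr_fun fun v => ?_
  by_cases h1 : Even v.1 <;> by_cases h2 : Even v.2 <;> simp [h1, h2, parity_simps]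

theorem thetaGen_functional_equation {α : ℝ} (hα : 0 < α) (w : ℂ) :
    thetaGen α w = 2 / (Real.sqrt 3 * α) *
      thetaGen (4 / (3 * α)) (2 / (Real.sqrt 3 * α) * w) := by
  have hβ : 0 < α / 4 := by positivity
  have hγ : 0 < 3 * α / 4 := by positivity
  have hα' : (α : ℂ) ≠ 0 := ofReal_ne_zero.2 hα.ne'
  have h3' : (Real.sqrt 3 : ℂ) ≠ 0 := ofReal_ne_zero.2 (by positivity)
  have hsq : (Real.sqrt (α / 4) : ℂ) * Real.sqrt (3 * α / 4) = Real.sqrt 3 * α / 4 := by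
    rw [← ofReal_mul, ← Real.sqrt_mul hβ.le,
      show α / 4 * (3 * α / 4) = 3 * (α / 4) ^ 2 by ring, Real.sqrt_mul (by norm_num),
      Real.sqrt_sq hβ.le]
    push_cast
    ring
  have hA := hasSum_mul_of_hasSum (hasSum_jacobiTheta₂_poisson hβ (w / 2))
    (hasSum_jacobiTheta₂_poisson hγ (sqrtNegThree * w / 2))
  have hB := hasSum_mul_of_hasSum (hasSum_jacobiTheta₂_poisson hβ (w / 2 + 1 / 2))
    (hasSum_jacobiTheta₂_poisson hγ (sqrtNegThree * w / 2 + 1 / 2))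
  set G : ℂ → ℂ := gaussKernel (4 / (3 * α)) (2 / (Real.sqrt 3 * α) * w) with hG
  have hS := hasSum_even_add_odd (G := fun v => G (((v.1 : ℂ) + v.2 * sqrtNegThree) / 2))
    (hA.congr_fun fun v => ?_) (hB.congr_fun fun v => ?_)
  · have hu := ((hasSum_coe_iff G _).1 (summable_gaussKernel (by positivity) _).hasSum).unique hS
    rw [thetaGen_eq_jacobi hα, thetaGen, hu]
    rw [show ∀ x y z u v w : ℂ, x * y * (z * u) + x * v * (z * w) = (x * z) * (y * u + v * w) from
      fun _ _ _ _ _ _ => by ring, hsq]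
    field_simp
    ring
  · have := exp_mul_exp_eq_gaussKernel hα w v.1 v.2 (2 * v.2) (-(2 * v.1)) (by push_cast; ring)
      (by push_cast; ring)
    rw [hG, ← this]
    push_cast
    rfl
  · have := exp_mul_exp_eq_gaussKernel hα w (v.1 - 1 / 2) (v.2 - 1 / 2) (2 * v.2 - 1)
      (-(2 * v.1 - 1)) (by push_cast; ring) (by push_cast; ring)
    rw [hG, ← this]
    push_cast
    congr 3 <;> ring

end Theta
-- Theta series with coefficients `x ^ k`.
section HarmonicTheta

/-- The theta series `∑ xᵏ exp (-π α |x|²)` over `x ∈ 𝓞 K`. -/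
noncomputable def harmonicTheta (k : ℕ) (α : ℝ) : ℂ :=
  ∑' x : 𝓞 K, ((x : K) : ℂ) ^ k * Real.exp (-(Real.pi * α * ‖((x : K) : ℂ)‖ ^ 2))

lemma summable_pow_mul_exp {α : ℝ} (hα : 0 < α) (k : ℕ) :
    Summable fun x : 𝓞 K =>
      ‖((x : K) : ℂ)‖ ^ k * Real.exp (-(Real.pi * α * ‖((x : K) : ℂ)‖ ^ 2)) := by
  refine ((summable_exp_neg_norm_sq hα (1 / (2 * Real.pi)) (by positivity)).mul_left
    (k.factorial : ℝ)).of_nonneg_of_le (fun _ => by positivity) fun x => ?_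
  have h := Real.pow_div_factorial_le_exp _ (norm_nonneg ((x : K) : ℂ)) k
  rw [div_le_iff₀ (by positivity)] at h
  rw [Real.exp_add, show 2 * Real.pi * (1 / (2 * Real.pi)) = 1 by
    field_simp, one_mul]
  calc _ ≤ (Real.exp ‖((x : K) : ℂ)‖ * k.factorial) *
        Real.exp (-(Real.pi * α * ‖((x : K) : ℂ)‖ ^ 2)) := by gcongr
    _ = _ := by ring

lemma norm_harmonicTheta_term (k : ℕ) (α : ℝ) (z : ℂ) :
    ‖z ^ k * (Real.exp (-(Real.pi * α * ‖z‖ ^ 2)) : ℂ)‖ =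
      ‖z‖ ^ k * Real.exp (-(Real.pi * α * ‖z‖ ^ 2)) := by
  rw [norm_mul, norm_pow, norm_real, Real.norm_of_nonneg (Real.exp_pos _).le]

lemma hasSum_harmonicTheta {α : ℝ} (hα : 0 < α) (k : ℕ) :
    HasSum (fun x : 𝓞 K => ((x : K) : ℂ) ^ k *
      (Real.exp (-(Real.pi * α * ‖((x : K) : ℂ)‖ ^ 2)) : ℂ)) (harmonicTheta k α) :=
  ((summable_pow_mul_exp hα k).of_norm_bounded
    fun _ => (norm_harmonicTheta_term _ _ _).le).hasSum

theorem hasSum_thetaGen {α : ℝ} (hα : 0 < α) (w : ℂ) :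
    HasSum (fun n : ℕ => w ^ n * ((2 * Real.pi * I) ^ n / n.factorial * harmonicTheta n α))
      (thetaGen α w) := by
  set F : 𝓞 K × ℕ → ℂ := fun v => (Real.exp (-(Real.pi * α * ‖((v.1 : K) : ℂ)‖ ^ 2)) : ℂ) *
    ((2 * Real.pi * I * w * ((v.1 : K) : ℂ)) ^ v.2 / v.2.factorial) with hF
  have hexp : ∀ x : 𝓞 K, HasSum (fun n => F (x, n)) (gaussKernel α w ((x : K) : ℂ)) := fun x => by
    have := (NormedSpace.expSeries_div_hasSum_exp (2 * Real.pi * I * w * ((x : K) : ℂ))).mul_left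
      (Real.exp (-(Real.pi * α * ‖((x : K) : ℂ)‖ ^ 2)) : ℂ)
    rw [← Complex.exp_eq_exp_ℂ, ofReal_exp, ← exp_add] at this
    rw [gaussKernel]
    convert! this using 2
    · simp only [hF, ofReal_exp]
    · push_cast; rfl
  have hnorm : ∀ x : 𝓞 K, HasSum (fun n => ‖F (x, n)‖)
      (Real.exp (-(Real.pi * α * ‖((x : K) : ℂ)‖ ^ 2) +
        2 * Real.pi * ‖w‖ * ‖((x : K) : ℂ)‖)) := fun x => by
    have := (NormedSpace.expSeries_div_hasSum_exp
      (2 * Real.pi * ‖w‖ * ‖((x : K) : ℂ)‖)).mul_left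
      (Real.exp (-(Real.pi * α * ‖((x : K) : ℂ)‖ ^ 2)))
    rw [← Real.exp_eq_exp_ℝ, ← Real.exp_add] at this
    refine this.congr_fun fun n => ?_
    simp only [hF, norm_mul, norm_div, norm_pow, norm_real, norm_I, mul_one, norm_ofNat,
      Real.norm_of_nonneg Real.pi_pos.le, Real.norm_of_nonneg (Real.exp_pos _).le, RCLike.norm_natCast]
  have hS : Summable F := by
    refine Summable.of_norm ((summable_prod_of_nonneg fun _ => norm_nonneg _).2
      ⟨fun x => (hnorm x).summable, ?_⟩)
    simp only [(hnorm _).tsum_eq]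
    exact summable_exp_neg_norm_sq hα _ (norm_nonneg _)
  have h1 := hS.hasSum.prod_fiberwise hexp
  have h2 : HasSum (F ∘ Equiv.prodComm ℕ (𝓞 K)) (∑' v, F v) :=
    (Equiv.prodComm ℕ (𝓞 K)).hasSum_iff.2 hS.hasSum
  rw [thetaGen, h1.tsum_eq]
  refine h2.prod_fiberwise fun n => ?_
  rw [← mul_assoc]
  have := (hasSum_harmonicTheta hα n).mul_left (w ^ n * ((2 * Real.pi * I) ^ n / n.factorial))
  refine this.congr_fun fun x => ?_
  simp only [hF, Function.comp, Equiv.prodComm_apply, Prod.swap]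
  rw [mul_pow, mul_pow _ w]
  ring

lemma coeff_unique {a b : ℕ → ℂ} {f : ℂ → ℂ} (ha : ∀ w, HasSum (fun n => w ^ n * a n) (f w))
    (hb : ∀ w, HasSum (fun n => w ^ n * b n) (f w)) : a = b := by
  have key : ∀ c : ℕ → ℂ, (∀ w, HasSum (fun n => w ^ n * c n) (f w)) →
      HasFPowerSeriesAt f (FormalMultilinearSeries.ofScalars ℂ c) 0 := fun c hc => by
    rw [hasFPowerSeriesAt_iff]
    refine Eventually.of_forall fun z => ?_
    simpa [FormalMultilinearSeries.coeff_ofScalars] using hc z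
  exact FormalMultilinearSeries.ofScalars_series_injective ℂ ℂ
    ((key a ha).eq_formalMultilinearSeries (key b hb))

/-- Comparison of the coefficients of `w ^ k`: rescaling `w` by `2 / (√3 α)` gives `k` factors, and
the prefactor gives one more. -/
theorem harmonicTheta_functional_equation {α : ℝ} (hα : 0 < α) (k : ℕ) :
    harmonicTheta k α =
      (2 / (Real.sqrt 3 * α)) ^ (k + 1) * harmonicTheta k (4 / (3 * α)) := by
  have h := coeff_unique (hasSum_thetaGen hα)
    (b := fun n => (2 * Real.pi * I) ^ n / n.factorial *
      ((2 / (Real.sqrt 3 * α)) ^ (n + 1) * harmonicTheta n (4 / (3 * α)))) fun w => by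
    rw [thetaGen_functional_equation hα]
    refine ((hasSum_thetaGen (by positivity) _).mul_left _).congr_fun fun n => ?_
    rw [mul_pow]
    ring
  have h' := congrFun h k
  have h0 : (2 * Real.pi * I) ^ k / (k.factorial : ℂ) ≠ 0 :=
    div_ne_zero (pow_ne_zero _ two_pi_I_ne_zero) (by exact_mod_cast k.factorial_ne_zero)
  exact mul_left_cancel₀ h0 h'

/-- The self-dual normalisation of `harmonicTheta`. -/
noncomputable def dualTheta (k : ℕ) (t : ℝ) : ℂ := harmonicTheta k (2 / Real.sqrt 3 * t)

theorem dualTheta_one_div (k : ℕ) {t : ℝ} (ht : 0 < t) :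
    dualTheta k (1 / t) = (t : ℂ) ^ (k + 1) * dualTheta k t := by
  have h3 : Real.sqrt 3 * Real.sqrt 3 = 3 := Real.mul_self_sqrt (by norm_num)
  have h3' : 0 < Real.sqrt 3 := by positivity
  rw [dualTheta, harmonicTheta_functional_equation (by positivity), dualTheta]
  have e1 : 2 / (Real.sqrt 3 * (2 / Real.sqrt 3 * (1 / t))) = t := by field_simp
  have e2 : 4 / (3 * (2 / Real.sqrt 3 * (1 / t))) = 2 / Real.sqrt 3 * t := by
    field_simp
    nlinarith [h3]
  rw [e2]
  congr 2
  exact_mod_cast congrArg ofReal e1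

lemma continuousOn_harmonicTheta (k : ℕ) : ContinuousOn (harmonicTheta k) (Set.Ioi 0) := by
  intro α hα
  have hα' : 0 < α / 2 := half_pos hα
  have h : ContinuousOn (harmonicTheta k) (Set.Ioi (α / 2)) := by
    refine continuousOn_tsum (fun x => by fun_prop) (summable_pow_mul_exp hα' k) fun x β hβ => ?_
    rw [norm_harmonicTheta_term]
    have : α / 2 ≤ β := le_of_lt hβ
    gcongr
  exact (h.continuousAt (Ioi_mem_nhds (half_lt_self hα))).continuousWithinAt

/-- For `k ≠ 0` the lattice point 0 contributes nothing, and all others have norm at least 1. The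
absence of a constant term is why the Mellin transform has no poles. -/
lemma norm_harmonicTheta_le {k : ℕ} (hk : k ≠ 0) : ∃ C : ℝ, ∀ α : ℝ, 1 ≤ α →
    ‖harmonicTheta k α‖ ≤ C * Real.exp (-α) := by
  have hS := (summable_pow_mul_exp one_pos k).mul_left (Real.exp Real.pi)
  refine ⟨_, fun α hα => (hasSum_harmonicTheta (by positivity) k).norm_le_of_bounded
    (hS.hasSum.mul_right (Real.exp (-α))) fun x => ?_⟩
  rw [norm_harmonicTheta_term]
  rcases eq_or_ne x 0 with rfl | hx
  · simp [hk]
  rw [mul_comm (Real.exp Real.pi), mul_assoc, mul_assoc, ← Real.exp_add, mul_assoc,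
    ← Real.exp_add]
  have h1 : 1 ≤ ‖((x : K) : ℂ)‖ ^ 2 := one_le_pow₀ (one_le_norm_coe hx)
  gcongr
  have hπ := Real.pi_gt_three
  nlinarith [mul_nonneg (mul_nonneg Real.pi_pos.le (sub_nonneg.2 hα)) (sub_nonneg.2 h1)]

end HarmonicTheta
-- The completed L-function as a Mellin transform.
section CompletedLFunction

open Set Asymptotics

lemma dualTheta_isBigO {k : ℕ} (hk : k ≠ 0) (r : ℝ) :
    (fun t => dualTheta k t - 0) =O[atTop] (fun t : ℝ => t ^ r) := by
  obtain ⟨C, hC⟩ := norm_harmonicTheta_le hk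
  have h1 : (1 : ℝ) ≤ 2 / Real.sqrt 3 := by
    rw [le_div_iff₀ (by positivity), one_mul, Real.sqrt_le_left (by norm_num)]
    norm_num
  have h2 : (fun t => dualTheta k t - 0) =O[atTop] (fun t : ℝ => Real.exp (-1 * t)) := by
    refine IsBigO.of_bound |C| ?_
    filter_upwards [eventually_ge_atTop 1] with t ht
    have h3 : t ≤ 2 / Real.sqrt 3 * t := le_mul_of_one_le_left (by positivity) h1
    rw [sub_zero, dualTheta, Real.norm_of_nonneg (Real.exp_pos _).le]
    refine (hC _ (ht.trans h3)).trans ?_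
    gcongr
    · exact le_abs_self C
    · linarith
  exact h2.trans (isLittleO_exp_neg_mul_rpow_atTop one_pos r).isBigO

lemma continuousOn_dualTheta (k : ℕ) : ContinuousOn (dualTheta k) (Ioi 0) :=
  (continuousOn_harmonicTheta k).comp (f := fun t : ℝ => 2 / Real.sqrt 3 * t) (s := Ioi (0 : ℝ))
    (by fun_prop) fun t (ht : 0 < t) => show 0 < 2 / Real.sqrt 3 * t by positivity

/-- The self-dual pair given by the theta series with coefficients `x ^ k`. -/
noncomputable def thetaPair (k : ℕ) (hk : k ≠ 0) : WeakFEPair ℂ where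
  f := dualTheta k
  g := dualTheta k
  k := k + 1
  ε := 1
  f₀ := 0
  g₀ := 0
  hf_int := (continuousOn_dualTheta k).locallyIntegrableOn measurableSet_Ioi
  hg_int := (continuousOn_dualTheta k).locallyIntegrableOn measurableSet_Ioi
  hk := by positivity
  hε := one_ne_zero
  h_feq := fun t ht => by
    rw [dualTheta_one_div k ht, one_mul, smul_eq_mul]
    congr 1
    rw [← ofReal_pow, ← Real.rpow_natCast]
    push_cast
    rfl
  hf_top := dualTheta_isBigO hk
  hg_top := dualTheta_isBigO hk

lemma isStrongFEPair_thetaPair (k : ℕ) (hk : k ≠ 0) : IsStrongFEPair (thetaPair k hk) := ⟨rfl, rfl⟩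

/-- The completed L-function of `χ^{6A}`, up to a constant factor. -/
noncomputable def completedHecke (A : ℕ) (s : ℂ) : ℂ := mellin (dualTheta (6 * A)) (s + 3 * A)

lemma six_mul_ne_zero {A : ℕ} (hA : A ≠ 0) : 6 * A ≠ 0 := by omega

lemma differentiable_completedHecke {A : ℕ} (hA : A ≠ 0) : Differentiable ℂ (completedHecke A) := by
  have h := (isStrongFEPair_thetaPair _ (six_mul_ne_zero hA)).differentiable_Λ
  rw [(isStrongFEPair_thetaPair _ (six_mul_ne_zero hA)).Λ_eq] at h
  exact h.comp (differentiable_id.add_const _)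

/-- The pair has weight `6A + 1`; the shift by `3A` turns the reflection `u ↦ 6A + 1 - u` into `s ↦
1 - s`. -/
lemma completedHecke_one_sub {A : ℕ} (hA : A ≠ 0) (s : ℂ) :
    completedHecke A (1 - s) = completedHecke A s := by
  have hP := isStrongFEPair_thetaPair _ (six_mul_ne_zero hA)
  have h := (thetaPair _ (six_mul_ne_zero hA)).functional_equation (s + 3 * A)
  rw [hP.Λ_eq, hP.symm_Λ_eq] at h
  simp only [thetaPair, one_smul] at h
  rw [completedHecke, completedHecke, ← h]
  congr 1
  push_cast
  ring

lemma norm_completedHecke_le {A : ℕ} (hA : A ≠ 0) (σ₁ σ₂ : ℝ) :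
    ∃ C : ℝ, ∀ s : ℂ, σ₁ ≤ s.re → s.re ≤ σ₂ → ‖completedHecke A s‖ ≤ C := by
  have hP := isStrongFEPair_thetaPair _ (six_mul_ne_zero hA)
  have hint : ∀ s : ℂ, MellinConvergent (dualTheta (6 * A)) s := fun s => (hP.hasMellin s).1
  refine ⟨∫ t : ℝ in Ioi 0, (‖(t : ℂ) ^ ((σ₁ + 3 * A : ℂ) - 1) • dualTheta (6 * A) t‖ +
    ‖(t : ℂ) ^ ((σ₂ + 3 * A : ℂ) - 1) • dualTheta (6 * A) t‖), fun s h1 h2 => ?_⟩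
  rw [completedHecke, mellin]
  refine MeasureTheory.norm_integral_le_of_norm_le
    ((hint _).norm.add (hint _).norm) ?_
  filter_upwards [MeasureTheory.ae_restrict_mem measurableSet_Ioi] with t ht
  have ht' : 0 < t := ht
  simp only [norm_smul, norm_cpow_eq_rpow_re_of_pos ht', ← add_mul]
  gcongr
  simp only [sub_re, add_re, ofReal_re, one_re, mul_re, natCast_re, natCast_im, mul_zero, sub_zero,
    re_ofNat]
  rcases le_total 1 t with h | h
  · refine (Real.rpow_le_rpow_of_exponent_le h ?_).trans (le_add_of_nonneg_left (by positivity))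
    linarith
  · refine (Real.rpow_le_rpow_of_exponent_ge ht' h ?_).trans
      (le_add_of_nonneg_right (by positivity))
    linarith

instance : Finite (𝓞 K)ˣ := by
  have hζ := IsCyclotomicExtension.zeta_spec 3 ℚ K
  refine Set.finite_univ_iff.1 ((List.finite_toSet _).subset
    fun u _ => IsCyclotomicExtension.Rat.Three.Units.mem hζ u)

lemma span_generator_mul_unit (I : Ideal (𝓞 K)) (u : (𝓞 K)ˣ) :
    Ideal.span {Submodule.IsPrincipal.generator I * (u : 𝓞 K)} = I := by
  rw [Ideal.span_singleton_mul_right_unit u.isUnit, Ideal.span_singleton_generator]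

/-- Each nonzero ideal has exactly one generator per unit. -/
lemma hasSum_span {g : Ideal (𝓞 K) → ℂ} (h0 : g ⊥ = 0) {S : ℂ} (hg : HasSum g S) :
    HasSum (fun x : 𝓞 K => g (Ideal.span {x})) (Nat.card (𝓞 K)ˣ * S) := by
  have := Fintype.ofFinite (𝓞 K)ˣ
  have hi : Function.Injective (fun v : {I : Ideal (𝓞 K) // I ≠ ⊥} × (𝓞 K)ˣ =>
      Submodule.IsPrincipal.generator v.1.1 * (v.2 : 𝓞 K)) := by
    rintro ⟨⟨I, hI⟩, u⟩ ⟨⟨J, hJ⟩, v⟩ h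
    simp only at h
    have hIJ : I = J := by
      rw [← span_generator_mul_unit I u, h, span_generator_mul_unit]
    subst hIJ
    have hne : Submodule.IsPrincipal.generator I ≠ 0 := fun h0 =>
      hI ((Submodule.IsPrincipal.eq_bot_iff_generator_eq_zero I).2 h0)
    have := mul_left_cancel₀ hne h
    rw [Units.ext this]
  refine (hi.hasSum_iff ?_).1 ?_
  · intro x hx
    rcases eq_or_ne x 0 with rfl | hx0
    · simpa using h0
    · obtain ⟨u, hu⟩ : Associated (Submodule.IsPrincipal.generator (Ideal.span {x})) x := by
        rw [← Ideal.span_singleton_eq_span_singleton, Ideal.span_singleton_generator]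
      exact absurd ⟨(⟨Ideal.span {x}, by simpa using hx0⟩, u), hu⟩ hx
  · have hg' : HasSum (fun I : {I : Ideal (𝓞 K) // I ≠ ⊥} => g I) S := by
      refine (Function.Injective.hasSum_iff Subtype.val_injective ?_).2 hg
      intro I hI
      by_cases h : I = ⊥
      · rw [h, h0]
      · exact absurd ⟨⟨I, h⟩, rfl⟩ hI
    have hu : HasSum (fun _ : (𝓞 K)ˣ => (1 : ℂ)) (Nat.card (𝓞 K)ˣ) := by
      simpa [Nat.card_eq_fintype_card] using hasSum_fintype fun _ : (𝓞 K)ˣ => (1 : ℂ)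
    rw [mul_comm]
    refine (hasSum_mul_of_hasSum hg' hu).congr_fun fun v => ?_
    simp only [Function.comp, span_generator_mul_unit, mul_one]

lemma heckeFun_bot (a : ℤ) {s : ℂ} (hs : s ≠ 0) : heckeFun a s ⊥ = 0 := by
  simp [heckeFun, hs]

/-- The shift by `3A` contributes `|x| ^ (6A)` to the denominator, which normalises `x ^ (6A)` to
the value of the character. -/
lemma pow_div_cpow_eq {A : ℕ} (hA : A ≠ 0) {s : ℂ} (hs : s ≠ 0) (x : 𝓞 K) :
    ((x : K) : ℂ) ^ (6 * A) / ((2 * Real.pi / Real.sqrt 3 * ‖((x : K) : ℂ)‖ ^ 2 : ℝ) : ℂ) ^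
      (s + 3 * A) = ((2 * Real.pi / Real.sqrt 3 : ℝ) : ℂ) ^ (-(s + 3 * A)) *
        heckeFun A s (Ideal.span {x}) := by
  rcases eq_or_ne x 0 with rfl | hx
  · rw [Ideal.span_singleton_zero, heckeFun_bot _ hs]
    simp [six_mul_ne_zero hA]
  have hn : (‖((x : K) : ℂ)‖ : ℂ) ≠ 0 := ofReal_ne_zero.2 (norm_ne_zero_iff.2 (coe_ne_zero hx))
  have hN : ((Ideal.absNorm (Ideal.span {x}) : ℕ) : ℂ) = (‖((x : K) : ℂ)‖ : ℂ) ^ 2 := by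
    exact_mod_cast congrArg ofReal (norm_sq_eq_absNorm x).symm
  have e : (6 * (A : ℤ)) = ((6 * A : ℕ) : ℤ) := by push_cast; rfl
  rw [heckeFun, heckeChar_span, angularChar, e, zpow_natCast, hN, ofReal_mul,
    mul_cpow_ofReal_nonneg (by positivity) (by positivity), ofReal_pow, cpow_neg,
    cpow_add _ _ (pow_ne_zero 2 hn), div_pow,
    show (3 * A : ℂ) = ((3 * A : ℕ) : ℂ) by push_cast; rfl, cpow_natCast, ← pow_mul,
    show 2 * (3 * A) = 6 * A by ring]
  field_simp

theorem completedHecke_eq {A : ℕ} (hA : A ≠ 0) {s : ℂ} (hs : 1 < s.re) :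
    completedHecke A s = Nat.card (𝓞 K)ˣ * Gamma (s + 3 * A) *
      ((2 * Real.pi / Real.sqrt 3 : ℝ) : ℂ) ^ (-(s + 3 * A)) * heckeSum A s := by
  have hre : (s + 3 * A).re = s.re + 3 * A := by simp
  have hpos : 0 < (s + 3 * A).re := by rw [hre]; positivity
  have hsum := (hasSum_span (g := heckeFun A s) ?_ (hasSum_heckeFun A hs)).mul_left
    (((2 * Real.pi / Real.sqrt 3 : ℝ) : ℂ) ^ (-(s + 3 * A)))
  · simp only [← pow_div_cpow_eq hA (ne_zero_of_one_lt_re hs)] at hsum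
    have h := hasSum_mellin (a := fun x : 𝓞 K => ((x : K) : ℂ) ^ (6 * A))
      (p := fun x => 2 * Real.pi / Real.sqrt 3 * ‖((x : K) : ℂ)‖ ^ 2)
      (F := dualTheta (6 * A)) (s := s + 3 * A) (fun x => ?_) hpos (fun t ht => ?_) ?_
    · refine h.unique ?_
      convert! hsum.mul_left (Gamma (s + 3 * A)) using 1
      · funext x; rw [mul_div_assoc]
      · ring
    · rcases eq_or_ne x 0 with rfl | hx
      · left; simp [six_mul_ne_zero hA]
      · right
        have := one_le_norm_coe hx
        positivity
    · refine (hasSum_harmonicTheta (mul_pos (by positivity) ht) (6 * A)).congr_fun fun x => ?_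
      rw [neg_mul]
      congr 4
      ring
    · refine hsum.summable.norm.congr fun x => ?_
      rw [norm_div]
      congr 1
      rw [norm_cpow_eq_rpow_re_of_nonneg (by positivity) hpos.ne']
  · exact heckeFun_bot _ (ne_zero_of_one_lt_re hs)

end CompletedLFunction
-- Entire continuation, for both signs of `a`.
section Continuation

/-- The entire continuation of `heckeSum A` for `A > 0`. -/
noncomputable def heckeEntire (A : ℕ) (s : ℂ) : ℂ :=
  completedHecke A s * ((2 * Real.pi / Real.sqrt 3 : ℝ) : ℂ) ^ (s + 3 * A) *
    (Gamma (s + 3 * A))⁻¹ / Nat.card (𝓞 K)ˣ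

lemma two_pi_div_sqrt_three_pos : 0 < 2 * Real.pi / Real.sqrt 3 := by positivity

lemma differentiable_heckeEntire {A : ℕ} (hA : A ≠ 0) : Differentiable ℂ (heckeEntire A) := by
  have h1 := differentiable_completedHecke hA
  have h2 : Differentiable ℂ fun s : ℂ => ((2 * Real.pi / Real.sqrt 3 : ℝ) : ℂ) ^ (s + 3 * A) :=
    (differentiable_id.add_const _).const_cpow
      (Or.inl (ofReal_ne_zero.2 two_pi_div_sqrt_three_pos.ne'))
  have h3 : Differentiable ℂ fun s : ℂ => (Gamma (s + 3 * A))⁻¹ :=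
    differentiable_one_div_Gamma.comp (differentiable_id.add_const _)
  exact ((h1.mul h2).mul h3).div_const _

lemma card_units_ne_zero : (Nat.card (𝓞 K)ˣ : ℂ) ≠ 0 := by
  exact_mod_cast Nat.card_pos.ne'

lemma heckeEntire_eq {A : ℕ} (hA : A ≠ 0) {s : ℂ} (hs : 1 < s.re) :
    heckeEntire A s = heckeSum A s := by
  have hpos : 0 < (s + 3 * A).re := by
    have hre : (s + 3 * A).re = s.re + 3 * A := by simp
    rw [hre]; positivity
  have hc : ((2 * Real.pi / Real.sqrt 3 : ℝ) : ℂ) ≠ 0 :=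
    ofReal_ne_zero.2 two_pi_div_sqrt_three_pos.ne'
  have hu := card_units_ne_zero
  have hG := Gamma_ne_zero_of_re_pos hpos
  have hcp : ((2 * Real.pi / Real.sqrt 3 : ℝ) : ℂ) ^ (s + 3 * A) ≠ 0 := by
    simp [cpow_eq_zero_iff, -ofReal_div, hc]
  rw [heckeEntire, completedHecke_eq hA hs, cpow_neg]
  field_simp

theorem isHeckeLFunction_heckeEntire {A : ℕ} (hA : A ≠ 0) :
    IsHeckeLFunction A (heckeEntire A) where
  differentiable := differentiable_heckeEntire hA
  hasSum s hs := by
    rw [heckeEntire_eq hA hs, hasSum_heckeTerm_iff _ (ne_zero_of_one_lt_re hs)]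
    exact hasSum_heckeFun A hs

lemma heckeChar_neg (a : ℤ) (I : Ideal (𝓞 K)) :
    heckeChar (-a) I = starRingEnd ℂ (heckeChar a I) := by
  rcases eq_or_ne I ⊥ with rfl | hI
  · have h0 : Submodule.IsPrincipal.generator (⊥ : Ideal (𝓞 K)) = 0 :=
      (Submodule.IsPrincipal.eq_bot_iff_generator_eq_zero _).1 rfl
    rcases eq_or_ne a 0 with rfl | ha
    · simp [heckeChar_zero_left]
    · rw [heckeChar, heckeChar, h0, angularChar, angularChar]
      simp [zero_zpow, ha]
  · have h1 : heckeChar a I * heckeChar (-a) I = 1 := by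
      have hg : Submodule.IsPrincipal.generator I ≠ 0 := fun h0 =>
        hI ((Submodule.IsPrincipal.eq_bot_iff_generator_eq_zero I).2 h0)
      have hx := coe_ne_zero hg
      rw [heckeChar, heckeChar, angularChar, angularChar, ← zpow_add₀
        (div_ne_zero hx (ofReal_ne_zero.2 (norm_ne_zero_iff.2 hx)))]
      simp
    have h2 : heckeChar a I * starRingEnd ℂ (heckeChar a I) = 1 := by
      rw [mul_conj, normSq_eq_norm_sq, norm_heckeChar a hI]; simp
    have h3 : heckeChar a I ≠ 0 := left_ne_zero_of_mul_eq_one h1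
    exact mul_left_cancel₀ h3 (h1.trans h2.symm)

/-- Negating `a` conjugates the character, so negative `a` reduces to `|a|`, the only case in which
theta series are used. -/
lemma IsHeckeLFunction.neg {a : ℤ} {L : ℂ → ℂ} (hL : IsHeckeLFunction a L) :
    IsHeckeLFunction (-a) (starRingEnd ℂ ∘ L ∘ starRingEnd ℂ) where
  differentiable := fun s => differentiableAt_conj_conj_iff.2 (hL.differentiable _)
  hasSum s hs := by
    have h := hL.hasSum (starRingEnd ℂ s) (by simpa using hs)
    refine (hasSum_conj'.2 h).congr_fun fun I => ?_
    rw [heckeTerm, heckeTerm, heckeChar_neg, map_div₀]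
    congr 1
    have harg : ((Ideal.absNorm I.1 : ℕ) : ℂ).arg ≠ Real.pi := by
      rw [natCast_arg]; exact Real.pi_pos.ne
    rw [cpow_conj _ _ harg, conj_conj, conj_natCast]

theorem isHeckeLFunction_heckeL {a : ℤ} (ha : a ≠ 0) : IsHeckeLFunction a (heckeL a) := by
  have h : ∃ L : ℂ → ℂ, IsHeckeLFunction a L := by
    have hA := isHeckeLFunction_heckeEntire (Int.natAbs_ne_zero.2 ha)
    rcases Int.natAbs_eq a with h | h
    · rw [← h] at hA
      exact ⟨_, hA⟩
    · have hA' := hA.neg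
      rw [← h] at hA'
      exact ⟨_, hA'⟩
  rw [heckeL, dif_pos h]
  exact h.choose_spec

lemma heckeL_eq_heckeSum {a : ℤ} (ha : a ≠ 0) {s : ℂ} (hs : 1 < s.re) :
    heckeL a s = heckeSum a s :=
  ((hasSum_heckeTerm_iff a (ne_zero_of_one_lt_re hs) _).1
    ((isHeckeLFunction_heckeL ha).hasSum s hs)).unique (hasSum_heckeFun a hs)

lemma norm_heckeL_eq {a : ℤ} (ha : a ≠ 0) (s : ℂ) :
    ∃ z : ℂ, z.re = s.re ∧ |z.im| = |s.im| ∧ ‖heckeL a s‖ = ‖heckeEntire a.natAbs z‖ := by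
  have hA := isHeckeLFunction_heckeEntire (Int.natAbs_ne_zero.2 ha)
  rcases Int.natAbs_eq a with h | h
  · refine ⟨s, rfl, rfl, ?_⟩
    rw [← h] at hA
    rw [(isHeckeLFunction_heckeL ha).unique hA]
  · refine ⟨starRingEnd ℂ s, by simp, by simp, ?_⟩
    have hA' := hA.neg
    rw [← h] at hA'
    rw [(isHeckeLFunction_heckeL ha).unique hA']
    simp

end Continuation

/-! ### A crude lower bound for Gamma, for the growth hypothesis of Phragmén–Lindelöf. -/

section GammaLowerBound

lemma norm_Gamma_le {z : ℂ} (hz : 0 < z.re) : ‖Gamma z‖ ≤ Real.Gamma z.re := by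
  rw [Gamma_eq_integral hz, Real.Gamma_eq_integral hz, GammaIntegral]
  refine MeasureTheory.norm_integral_le_of_norm_le (Real.GammaIntegral_convergent hz) ?_
  filter_upwards [MeasureTheory.ae_restrict_mem measurableSet_Ioi] with t ht
  rw [norm_mul, norm_real, Real.norm_of_nonneg (Real.exp_pos _).le,
    norm_cpow_eq_rpow_re_of_pos ht, sub_re, one_re]

lemma Gamma_le_one {x : ℝ} (h1 : 1 ≤ x) (h2 : x ≤ 2) : Real.Gamma x ≤ 1 := by
  have h := Real.convexOn_Gamma.le_max_of_mem_Icc (x := 1) (y := 2) (z := x)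
    (Set.mem_Ioi.2 one_pos) (Set.mem_Ioi.2 two_pos) ⟨h1, h2⟩
  simpa [Real.Gamma_two] using h

lemma norm_sin_le (z : ℂ) : ‖sin z‖ ≤ Real.exp |z.im| := by
  rw [sin, norm_div, norm_mul, norm_I, mul_one, norm_ofNat, div_le_iff₀ two_pos]
  refine (norm_sub_le _ _).trans ?_
  rw [norm_exp, norm_exp]
  have h1 : (-z * I).re ≤ |z.im| := by simpa using le_abs_self z.im
  have h2 : (z * I).re ≤ |z.im| := by simpa using neg_le_abs z.im
  linarith [Real.exp_le_exp.2 h1, Real.exp_le_exp.2 h2]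

lemma one_le_exp_mul_norm_Gamma_of_re_lt_one {w : ℂ} (h0 : 0 ≤ w.re) (h1 : w.re < 1)
    (him : 1 ≤ |w.im|) : 1 ≤ Real.exp (Real.pi * |w.im|) * ‖Gamma w‖ := by
  have hsin : sin (Real.pi * w) ≠ 0 := fun h => by
    obtain ⟨k, hk⟩ := sin_eq_zero_iff.1 h
    rw [mul_comm] at hk
    have := mul_right_cancel₀ (ofReal_ne_zero.2 Real.pi_ne_zero) hk
    rw [this, intCast_im, abs_zero] at him
    linarith
  have hne : 1 - w ≠ 0 := fun h => by
    have := congrArg im h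
    simp only [sub_im, one_im, zero_im] at this
    rw [show w.im = 0 by linarith, abs_zero] at him
    linarith
  have h2 : Gamma (2 - w) = (1 - w) * Gamma (1 - w) := by
    rw [← Gamma_add_one _ hne]
    congr 1
    ring
  -- Reflection is used with `2 - w` because its real part lies in `(1, 2]`, where the real Gamma
  -- function is at most 1.
  have key : Gamma w * Gamma (2 - w) * sin (Real.pi * w) = Real.pi * (1 - w) := by
    have := Gamma_mul_Gamma_one_sub w
    rw [eq_div_iff hsin] at this
    rw [h2]
    linear_combination (1 - w) * this
  have hn := congrArg norm key
  rw [norm_mul, norm_mul, norm_mul, norm_real, Real.norm_of_nonneg Real.pi_pos.le] at hn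
  have h3 : ‖Gamma (2 - w)‖ ≤ 1 := by
    have hre : (2 - w).re = 2 - w.re := by simp
    refine (norm_Gamma_le (by rw [hre]; linarith)).trans ?_
    rw [hre]
    exact Gamma_le_one (by linarith) (by linarith)
  have h4 : ‖sin (Real.pi * w)‖ ≤ Real.exp (Real.pi * |w.im|) := by
    refine (norm_sin_le _).trans_eq ?_
    rw [im_ofReal_mul, abs_mul, abs_of_pos Real.pi_pos]
  have h5 : 1 ≤ ‖1 - w‖ := by
    refine him.trans ?_
    have := abs_im_le_norm (1 - w)
    simpa using this
  calc (1 : ℝ) ≤ Real.pi * ‖1 - w‖ := by nlinarith [Real.pi_gt_three]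
    _ = ‖Gamma w‖ * ‖Gamma (2 - w)‖ * ‖sin (Real.pi * w)‖ := hn.symm
    _ ≤ ‖Gamma w‖ * 1 * Real.exp (Real.pi * |w.im|) := by gcongr
    _ = _ := by ring

lemma one_le_exp_mul_norm_Gamma {z : ℂ} (h0 : 0 ≤ z.re) (him : 1 ≤ |z.im|) :
    1 ≤ Real.exp (Real.pi * |z.im|) * ‖Gamma z‖ := by
  have key : ∀ (m : ℕ) (w : ℂ), 0 ≤ w.re → w.re < 1 → 1 ≤ |w.im| →
      1 ≤ Real.exp (Real.pi * |w.im|) * ‖Gamma (w + m)‖ := by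
    intro m w h0 h1 him
    induction m with
    | zero => simpa using one_le_exp_mul_norm_Gamma_of_re_lt_one h0 h1 him
    | succ m ih =>
      have hn : 1 ≤ ‖w + m‖ := him.trans (by simpa using abs_im_le_norm (w + m))
      rw [Nat.cast_succ, ← add_assoc, Gamma_add_one _ (norm_pos_iff.1 (by linarith)), norm_mul]
      refine ih.trans ?_
      gcongr
      exact le_mul_of_one_le_left (norm_nonneg _) hn
  have h := key ⌊z.re⌋₊ (z - ⌊z.re⌋₊) (by simpa using Nat.floor_le h0)
    (by simpa [sub_lt_iff_lt_add'] using Nat.lt_floor_add_one z.re) (by simpa using him)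
  simpa using h

end GammaLowerBound
-- Polynomial growth in vertical strips, uniformly in `a`.
section Convexity

open Asymptotics Set

/-- On the line `Re s = -1/2` the number `1 - s + 3A` is the conjugate of `s + 3A + 2`. The Gamma
quotient in the functional equation thus has norm exactly `‖z + 1‖ * ‖z‖` with `z = s + 3A`, and
Stirling's formula is not needed. -/
lemma norm_heckeEntire_le_of_re_eq {A : ℕ} (hA : A ≠ 0) {s : ℂ} (hs : s.re = -1 / 2) :
    ‖heckeEntire A s‖ ≤ zetaSum (3 / 2) * ‖s + 3 * A + 1‖ ^ 2 := by
  set z : ℂ := s + 3 * A with hz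
  have hA1 : (1 : ℝ) ≤ A := by exact_mod_cast Nat.one_le_iff_ne_zero.2 hA
  have hzre : z.re = 3 * A - 1 / 2 := by simp [hz, hs]; ring
  have hz0 : 0 < z.re := by rw [hzre]; linarith
  have hz1 : 0 < (z + 1).re := by rw [add_re, one_re]; linarith
  have hne : ∀ {w : ℂ}, 0 < w.re → w ≠ 0 := fun hw h => by simp [h] at hw
  have hs1 : (1 - s).re = 3 / 2 := by rw [sub_re, one_re, hs]; norm_num
  have hc := two_pi_div_sqrt_three_pos
  have hc1 : 1 ≤ 2 * Real.pi / Real.sqrt 3 := by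
    rw [le_div_iff₀ (by positivity), one_mul]
    have : Real.sqrt 3 ≤ 3 := by rw [Real.sqrt_le_left (by norm_num)]; norm_num
    linarith [Real.pi_gt_three]
  have hG : ‖Gamma (1 - s + 3 * A)‖ = ‖z + 1‖ * ‖z‖ * ‖Gamma z‖ := by
    have e : 1 - s + 3 * A = starRingEnd ℂ (z + 1 + 1) := by
      apply Complex.ext
      · simp [hz, hs]; ring
      · simp [hz]
    rw [e, Gamma_conj, norm_conj, Gamma_add_one _ (hne hz1), Gamma_add_one _ (hne hz0), norm_mul,
      norm_mul, mul_assoc]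
  have hGz : ‖Gamma z‖ ≠ 0 := norm_ne_zero_iff.2 (Gamma_ne_zero_of_re_pos hz0)
  have hL : ‖heckeSum A (1 - s)‖ ≤ zetaSum (3 / 2) := by
    have := norm_heckeSum_le A (s := 1 - s) (by rw [hs1]; norm_num)
    rwa [hs1] at this
  have hu : (Nat.card (𝓞 K)ˣ : ℝ) ≠ 0 := by exact_mod_cast Nat.card_pos.ne'
  have hzz : ‖z‖ ≤ ‖z + 1‖ := by
    rw [← sq_le_sq₀ (norm_nonneg _) (norm_nonneg _), ← normSq_eq_norm_sq, ← normSq_eq_norm_sq,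
      normSq_apply, normSq_apply]
    simp only [add_re, one_re, add_im, one_im, add_zero]
    nlinarith
  have hpow : (2 * Real.pi / Real.sqrt 3) ^ (-(1 - s + 3 * A).re) *
      (2 * Real.pi / Real.sqrt 3) ^ z.re ≤ 1 := by
    rw [← Real.rpow_add hc]
    refine Real.rpow_le_one_of_one_le_of_nonpos hc1 ?_
    simp [hz, hs]
    linarith
  have hnorm : ‖heckeEntire A s‖ = ((2 * Real.pi / Real.sqrt 3) ^ (-(1 - s + 3 * A).re) *
      (2 * Real.pi / Real.sqrt 3) ^ z.re) * (‖z + 1‖ * ‖z‖) * ‖heckeSum A (1 - s)‖ := by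
    rw [heckeEntire, ← completedHecke_one_sub hA, completedHecke_eq hA (by rw [hs1]; norm_num)]
    simp only [norm_mul, norm_div, norm_inv, norm_cpow_eq_rpow_re_of_pos hc, RCLike.norm_natCast,
      hG, ← hz, neg_re]
    field_simp
  rw [hnorm]
  have h0 : 0 ≤ zetaSum (3 / 2) := (zetaSum_pos (by norm_num)).le
  calc _ ≤ 1 * (‖z + 1‖ * ‖z + 1‖) * zetaSum (3 / 2) := by gcongr
    _ = _ := by ring

lemma heckeEntire_isBigO {A : ℕ} (hA : A ≠ 0) : ∃ B : ℝ,
    (fun s => heckeEntire A s / (s + 3 * A + 1) ^ 2)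
      =O[comap (_root_.abs ∘ im) atTop ⊓ 𝓟 (re ⁻¹' Ioo (-1 / 2) (3 / 2))]
      fun z ↦ Real.exp (B * Real.exp (1 * |z.im|)) := by
  obtain ⟨C, hC⟩ := norm_completedHecke_le hA (-1 / 2) (3 / 2)
  have hA1 : (1 : ℝ) ≤ A := by exact_mod_cast Nat.one_le_iff_ne_zero.2 hA
  have hc := two_pi_div_sqrt_three_pos
  have hu : (1 : ℝ) ≤ Nat.card (𝓞 K)ˣ := by exact_mod_cast Nat.card_pos
  set D : ℝ := (2 * Real.pi / Real.sqrt 3) ^ (-1 / 2 + 3 * A : ℝ) +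
    (2 * Real.pi / Real.sqrt 3) ^ (3 / 2 + 3 * A : ℝ) with hD
  refine ⟨Real.pi, IsBigO.of_bound (|C| * D) ?_⟩
  have hev : ∀ᶠ s in comap (_root_.abs ∘ im) atTop ⊓ 𝓟 (re ⁻¹' Ioo (-1 / 2) (3 / 2 : ℝ)),
      1 ≤ |s.im| := by
    refine Filter.Eventually.filter_mono inf_le_left ?_
    exact tendsto_comap.eventually (eventually_ge_atTop (1 : ℝ))
  filter_upwards [hev, mem_inf_of_right (mem_principal_self _)] with s him hs
  have hs1 : -1 / 2 < s.re := hs.1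
  have hs2 : s.re < 3 / 2 := hs.2
  have hre : (s + 3 * A).re = s.re + 3 * A := by simp
  have him' : (s + 3 * A).im = s.im := by simp
  have hG := one_le_exp_mul_norm_Gamma (z := s + 3 * A) (by rw [hre]; linarith)
    (by rwa [him'])
  rw [him'] at hG
  have hGpos : 0 < ‖Gamma (s + 3 * A)‖ := norm_pos_iff.2
    (Gamma_ne_zero_of_re_pos (by rw [hre]; linarith))
  have hGi : ‖Gamma (s + 3 * A)‖⁻¹ ≤ Real.exp (Real.pi * |s.im|) := by
    rwa [inv_le_iff_one_le_mul₀ hGpos]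
  have hpow : (2 * Real.pi / Real.sqrt 3) ^ (s.re + 3 * A) ≤ D := by
    rw [hD]
    rcases le_total 1 (2 * Real.pi / Real.sqrt 3) with h | h
    · refine (Real.rpow_le_rpow_of_exponent_le h ?_).trans
        (le_add_of_nonneg_left (by positivity))
      linarith
    · refine (Real.rpow_le_rpow_of_exponent_ge hc h ?_).trans
        (le_add_of_nonneg_right (by positivity))
      linarith
  have hden : 1 ≤ ‖(s + 3 * A + 1) ^ 2‖ := by
    rw [norm_pow]
    refine one_le_pow₀ (le_trans ?_ (re_le_norm _))
    rw [add_re, hre, one_re]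
    linarith
  have hexp : Real.exp (Real.pi * |s.im|) ≤ Real.exp (Real.pi * Real.exp (1 * |s.im|)) := by
    rw [one_mul]
    gcongr
    linarith [Real.add_one_le_exp |s.im|]
  rw [norm_div, Real.norm_of_nonneg (Real.exp_pos _).le]
  refine (div_le_self (norm_nonneg _) hden).trans ?_
  rw [heckeEntire, norm_div, norm_mul, norm_mul, RCLike.norm_natCast, norm_inv,
    norm_cpow_eq_rpow_re_of_pos hc, hre]
  refine (div_le_self (by positivity) hu).trans ?_
  have hC' := (hC s hs1.le hs2.le).trans (le_abs_self C)
  calc _ ≤ |C| * D * Real.exp (Real.pi * |s.im|) := by gcongr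
    _ ≤ _ := by gcongr

theorem norm_heckeEntire_le {A : ℕ} (hA : A ≠ 0) {s : ℂ} (h1 : -1 / 2 ≤ s.re)
    (h2 : s.re ≤ 3 / 2) : ‖heckeEntire A s‖ ≤ zetaSum (3 / 2) * ‖s + 3 * A + 1‖ ^ 2 := by
  have hA1 : (1 : ℝ) ≤ A := by exact_mod_cast Nat.one_le_iff_ne_zero.2 hA
  have hden : ∀ {s : ℂ}, -1 / 2 ≤ s.re → 1 ≤ ‖(s + 3 * A + 1) ^ 2‖ := fun {s} hs => by
    rw [norm_pow]
    refine one_le_pow₀ (le_trans ?_ (re_le_norm _))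
    simp
    linarith
  have hden0 : ∀ {s : ℂ}, -1 / 2 ≤ s.re → (s + 3 * A + 1) ^ 2 ≠ 0 := fun {s} hs =>
    norm_pos_iff.1 (one_pos.trans_le (hden hs))
  have hdiff : DifferentiableOn ℂ (fun s => heckeEntire A s / (s + 3 * A + 1) ^ 2)
      {s | -1 / 2 ≤ s.re} :=
    (differentiable_heckeEntire hA).differentiableOn.div (by fun_prop) fun s hs => hden0 hs
  have hcl : closure (re ⁻¹' Ioo (-1 / 2 : ℝ) (3 / 2)) ⊆ {s : ℂ | -1 / 2 ≤ s.re} :=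
    closure_minimal (fun s hs => le_of_lt hs.1) (isClosed_le continuous_const continuous_re)
  have h0 : 0 < zetaSum (3 / 2) := zetaSum_pos (by norm_num)
  -- The strip has width 2, so the growth exponent 1 is admissible because `1 < π / 2`.
  have key := PhragmenLindelof.vertical_strip (C := zetaSum (3 / 2)) (z := s)
    ((hdiff.mono hcl).diffContOnCl) ⟨1, ?_, heckeEntire_isBigO hA⟩ ?_ ?_ h1 h2
  · rw [norm_div, div_le_iff₀ (one_pos.trans_le (hden h1)), norm_pow] at key
    exact key
  · linarith [Real.pi_gt_three]
  · intro z hz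
    rw [norm_div, div_le_iff₀ (one_pos.trans_le (hden hz.ge)), norm_pow]
    exact norm_heckeEntire_le_of_re_eq hA hz
  · intro z hz
    rw [norm_div]
    refine (div_le_self (norm_nonneg _) (hden (by rw [hz]; norm_num))).trans ?_
    rw [heckeEntire_eq hA (by rw [hz]; norm_num)]
    have := norm_heckeSum_le A (s := z) (by rw [hz]; norm_num)
    rwa [hz] at this

theorem norm_heckeL_le {a : ℤ} (ha : a ≠ 0) {s : ℂ} (hs : -1 / 2 ≤ s.re) :
    ‖heckeL a s‖ ≤ 9 * zetaSum (3 / 2) * ((1 + |(a : ℝ)|) * (1 + |s.im|)) ^ 2 := by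
  have h0 : 0 < zetaSum (3 / 2) := zetaSum_pos (by norm_num)
  rcases le_or_gt s.re (3 / 2) with h2 | h2
  · obtain ⟨z, hre, him, h⟩ := norm_heckeL_eq ha s
    rw [h, mul_assoc, mul_left_comm, ← him]
    refine (norm_heckeEntire_le (Int.natAbs_ne_zero.2 ha) (hre ▸ hs) (hre ▸ h2)).trans ?_
    rw [show (9 : ℝ) = 3 ^ 2 by norm_num, ← mul_pow]
    gcongr
    have hA : ((a.natAbs : ℕ) : ℝ) = |(a : ℝ)| := by rw [Nat.cast_natAbs]; push_cast; rfl
    refine (norm_le_abs_re_add_abs_im _).trans ?_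
    have e1 : (z + 3 * (a.natAbs : ℕ) + 1).re = s.re + 3 * |(a : ℝ)| + 1 := by
      simp [hre, ← hA, -Nat.cast_natAbs]
    have e2 : (z + 3 * (a.natAbs : ℕ) + 1).im = z.im := by simp
    rw [e1, e2, abs_of_nonneg (by linarith [abs_nonneg (a : ℝ)])]
    nlinarith [mul_nonneg (abs_nonneg (a : ℝ)) (abs_nonneg z.im), abs_nonneg z.im]
  · have h3 : 1 < s.re := by linarith
    rw [heckeL_eq_heckeSum ha h3]
    refine ((norm_heckeSum_le a h3).trans (zetaSum_le_of_le (by norm_num) h2.le)).trans ?_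
    have h5 : 1 ≤ (1 + |(a : ℝ)|) * (1 + |s.im|) := one_le_mul_of_one_le_of_one_le
      (le_add_of_nonneg_right (abs_nonneg _)) (le_add_of_nonneg_right (abs_nonneg _))
    have h4 := one_le_pow₀ h5 (n := 2)
    nlinarith

end Convexity
-- The zero-free region.
section ZeroFreeRegion

lemma exists_mul_zetaSum_le : ∃ B > 0, ∃ δ > 0, ∀ η : ℝ, 0 < η → η ≤ δ →
    η * zetaSum (1 + η) ≤ B := by
  obtain ⟨κ, hκ, h⟩ := tendsto_sub_one_mul_zetaSum
  have h1 := h.eventually (eventually_le_nhds (lt_add_one κ))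
  rw [eventually_nhdsWithin_iff, Metric.eventually_nhds_iff] at h1
  obtain ⟨δ, hδ, h1⟩ := h1
  refine ⟨κ + 1, by linarith, δ / 2, half_pos hδ, fun η h0 hη => ?_⟩
  have := h1 (y := 1 + η) (by rw [Real.dist_eq, add_sub_cancel_left, abs_of_pos h0]; linarith)
    (Set.mem_Ioi.2 (by linarith))
  rwa [add_sub_cancel_left] at this

lemma heckeL_ne_zero_of_one_lt_re {a : ℤ} (ha : a ≠ 0) {s : ℂ} (hs : 1 < s.re) :
    heckeL a s ≠ 0 := by
  rw [heckeL_eq_heckeSum ha hs]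
  exact heckeSum_ne_zero a hs

lemma logDeriv_heckeL_eq {a : ℤ} (ha : a ≠ 0) {s : ℂ} (hs : 1 < s.re) :
    logDeriv (fun z => heckeL a (s + z)) 0 = logDeriv (heckeSum a) s := by
  have h : heckeL a =ᶠ[𝓝 s] heckeSum a := by
    filter_upwards [isOpen_one_lt_re.mem_nhds hs] with z hz
    exact heckeL_eq_heckeSum ha hz
  rw [logDeriv_apply, logDeriv_apply, deriv_comp_const_add, add_zero, h.deriv_eq, h.self_of_nhds]

/-- Landau's lemma on the unit disc about `1 + η + it`: zeros have real part at most 1, hence lie to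
the left of the centre. The condition `η ≤ β` places the zero `β + it` inside the disc. -/
theorem logDeriv_heckeSum_lower_bound {a : ℤ} (ha : a ≠ 0) {η t M : ℝ} (hη : 0 < η) (hM : 0 < M)
    (hb : 9 * zetaSum (3 / 2) * ((1 + |(a : ℝ)|) * (2 + |t|)) ^ 2 * zetaSum (1 + η)
      ≤ Real.exp M) :
    -(2 * M) ≤ (logDeriv (heckeSum a) ((1 + η : ℝ) + t * I)).re ∧
      ∀ β : ℝ, β < 1 + η → η ≤ β → heckeL a (β + t * I) = 0 →
        1 / (1 + η - β) - (1 + η - β) - 2 * M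
          ≤ (logDeriv (heckeSum a) ((1 + η : ℝ) + t * I)).re := by
  set s : ℂ := (1 + η : ℝ) + t * I with hs
  have hre : s.re = 1 + η := by simp [hs]
  have him : s.im = t := by simp [hs]
  have hs1 : 1 < s.re := by rw [hre]; linarith
  have hζ : 0 < zetaSum (1 + η) := zetaSum_pos (by linarith)
  have hζ' : 0 < zetaSum (3 / 2) := zetaSum_pos (by norm_num)
  have h0 : heckeL a (s + 0) ≠ 0 := by
    rw [add_zero]; exact heckeL_ne_zero_of_one_lt_re ha hs1
  have hlow : 1 ≤ ‖heckeL a (s + 0)‖ * zetaSum (1 + η) := by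
    rw [add_zero, heckeL_eq_heckeSum ha hs1, ← hre]
    exact one_le_norm_heckeSum_mul_zetaSum a hs1
  have hbound : ∀ z : ℂ, ‖z‖ = 1 → ‖heckeL a (s + z)‖ ≤ Real.exp M * ‖heckeL a (s + 0)‖ := by
    intro z hz
    have h1 : -1 ≤ z.re := by
      have := abs_re_le_norm z
      rw [hz] at this
      exact (abs_le.1 this).1
    have h2 : |(s + z).im| ≤ |t| + 1 := by
      rw [add_im, him]
      refine (abs_add_le _ _).trans ?_
      have := abs_im_le_norm z
      rw [hz] at this
      linarith
    have h3 := norm_heckeL_le ha (s := s + z) (by rw [add_re, hre]; linarith)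
    calc ‖heckeL a (s + z)‖ ≤ 9 * zetaSum (3 / 2) * ((1 + |(a : ℝ)|) * (1 + |(s + z).im|)) ^ 2 := h3
      _ ≤ 9 * zetaSum (3 / 2) * ((1 + |(a : ℝ)|) * (2 + |t|)) ^ 2 * 1 := by
        rw [mul_one]
        gcongr 9 * zetaSum (3 / 2) * ((1 + |(a : ℝ)|) * ?_) ^ 2
        linarith
      _ ≤ 9 * zetaSum (3 / 2) * ((1 + |(a : ℝ)|) * (2 + |t|)) ^ 2 *
          (‖heckeL a (s + 0)‖ * zetaSum (1 + η)) := by gcongr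
      _ = 9 * zetaSum (3 / 2) * ((1 + |(a : ℝ)|) * (2 + |t|)) ^ 2 * zetaSum (1 + η) *
          ‖heckeL a (s + 0)‖ := by ring
      _ ≤ _ := by gcongr
  have hzero : ∀ z : ℂ, ‖z‖ ≤ 1 → heckeL a (s + z) = 0 → z.re ≤ 0 := by
    intro z _ hz
    by_contra! h
    exact heckeL_ne_zero_of_one_lt_re ha (by rw [add_re, hre]; linarith) hz
  have hdiff : Differentiable ℂ fun z => heckeL a (s + z) :=
    (isHeckeLFunction_heckeL ha).differentiable.comp (differentiable_id.const_add _)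
  rw [← logDeriv_heckeL_eq ha hs1]
  refine ⟨(landau_lower_bound (d := 0) hM hdiff h0 hbound hzero).1, fun β h1 h2 h3 => ?_⟩
  refine (landau_lower_bound (d := 1 + η - β) hM hdiff h0 hbound hzero).2 (by linarith)
    (by linarith) ?_
  rw [← h3, hs]
  congr 1
  push_cast
  ring

lemma exists_small_parameter (D : ℝ) {δ : ℝ} (hδ : 0 < δ) :
    ∃ x : ℝ, 0 < x ∧ x ≤ 1 ∧ x ≤ δ ∧ D + 20 * Real.log (1 / x) < 3 / 10 * (1 / x) := by
  have h1 := Real.isLittleO_log_id_atTop.bound (show (0 : ℝ) < 1 / 200 by norm_num)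
  obtain ⟨y, hy, h2, h3, h4⟩ := (h1.and ((eventually_ge_atTop (1 : ℝ)).and
    ((eventually_ge_atTop (1 / δ)).and (eventually_gt_atTop (5 * D))))).exists
  have hy0 : 0 < y := by linarith
  refine ⟨1 / y, by positivity, ?_, ?_, ?_⟩
  · rw [div_le_one hy0]; exact h2
  · rwa [one_div_le hy0 hδ]
  · rw [one_div_one_div]
    have := (le_abs_self _).trans hy
    simp only [id, Real.norm_of_nonneg hy0.le] at this
    linarith

theorem exists_zeroFreeRegion : ∃ c : ℝ, 0 < c ∧ ∀ a : ℤ, a ≠ 0 → ∀ σ t : ℝ,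
    1 - 1 / (c * Real.log ((1 + |(a : ℝ)|) * (1 + |t|))) ≤ σ → heckeL a (σ + t * I) ≠ 0 := by
  obtain ⟨η₀, hη₀, hζ⟩ := exists_neg_logDeriv_zeta_le
  obtain ⟨B, hB, δ, hδ, hBδ⟩ := exists_mul_zetaSum_le
  have hζ' : 0 < zetaSum (3 / 2) := zetaSum_pos (by norm_num)
  set C : ℝ := max (Real.log (9 * zetaSum (3 / 2) * 16 * B)) 0 with hC
  have hC0 : 0 ≤ C := le_max_right _ _
  -- After division by `l`, the errors in the final inequality total `38 + 20 C + 20 log (1/x)`: ten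
  -- times the factor of `M`, plus 8 from `4d ≤ 8l`. The net gain `(40/11 - 33/10) / x` exceeds
  -- `(3/10) / x`. The halved bound on `x` allows for `η ≤ 2x`.
  obtain ⟨x, hx0, hx1, hxδ, hx⟩ := exists_small_parameter (38 + 20 * C)
    (δ := min (min η₀ δ) (1 / 2) / 2) (by positivity)
  refine ⟨10 / x, by positivity, fun a ha σ t hσ h0 => ?_⟩
  have ha1 : 1 ≤ |(a : ℝ)| := by exact_mod_cast Int.one_le_abs ha
  set X : ℝ := (1 + |(a : ℝ)|) * (1 + |t|) with hX
  have hX2 : 2 ≤ X := by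
    rw [hX]; nlinarith [abs_nonneg t, mul_nonneg (abs_nonneg (a : ℝ)) (abs_nonneg t)]
  set l : ℝ := Real.log X with hl
  have hl2 : 1 / 2 ≤ l := by
    have := Real.log_le_log two_pos hX2
    linarith [Real.log_two_gt_d9]
  have hl0 : 0 < l := by linarith
  set η : ℝ := x / l with hη
  have hη0 : 0 < η := by positivity
  have hη2 : η ≤ 2 * x := by
    rw [hη, div_le_iff₀ hl0]; nlinarith
  have hm1 := min_le_left (min η₀ δ) (1 / 2)
  have hm2 := min_le_right (min η₀ δ) (1 / 2)
  have hm3 := min_le_left η₀ δ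
  have hm4 := min_le_right η₀ δ
  have hσ1 : σ ≤ 1 := by
    by_contra! h
    exact heckeL_ne_zero_of_one_lt_re ha (by simpa using h) h0
  have hση : 1 - η / 10 ≤ σ := by
    refine le_trans (le_of_eq ?_) hσ
    rw [hη]
    field_simp
  set M : ℝ := (2 * C + 3 + 2 * Real.log (1 / x)) * l with hM
  have hlogx : 0 ≤ Real.log (1 / x) := Real.log_nonneg (by rw [le_div_iff₀ hx0]; linarith)
  have hM0 : 0 < M := by positivity
  have hexpM : 9 * zetaSum (3 / 2) * (4 * X) ^ 2 * zetaSum (1 + η) ≤ Real.exp M := by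
    have h1 : zetaSum (1 + η) ≤ B * (1 / η) := by
      rw [mul_one_div, le_div_iff₀ hη0, mul_comm]
      exact hBδ η hη0 (by linarith)
    have h2 : 9 * zetaSum (3 / 2) * 16 * B ≤ Real.exp C := by
      rw [← Real.log_le_iff_le_exp (by positivity)]
      exact le_max_left _ _
    have h3 : X ^ 2 = Real.exp (2 * l) := by
      rw [two_mul, Real.exp_add, hl, Real.exp_log (by linarith)]; ring
    have h4 : 1 / η ≤ Real.exp (Real.log (1 / x) + l) := by
      rw [Real.exp_add, Real.exp_log (by positivity), hη, one_div_div, div_eq_mul_one_div,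
        mul_comm]
      gcongr
      linarith [Real.add_one_le_exp l]
    calc _ ≤ 9 * zetaSum (3 / 2) * (4 * X) ^ 2 * (B * (1 / η)) := by gcongr
      _ = (9 * zetaSum (3 / 2) * 16 * B) * X ^ 2 * (1 / η) := by ring
      _ ≤ Real.exp C * Real.exp (2 * l) * Real.exp (Real.log (1 / x) + l) := by
        rw [h3]; gcongr
      _ = Real.exp (C + 2 * l + (Real.log (1 / x) + l)) := by
        rw [← Real.exp_add, ← Real.exp_add]
      _ ≤ _ := by
        gcongr
        rw [hM]
        nlinarith
  -- The factor 4 covers both applications: `(1 + |a|)(2 + |t|)` for the zero, and `(1 + 2|a|)(2 +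
  -- 2|t|)` for the doubled parameters.
  have hmono : ∀ Y : ℝ, 0 ≤ Y → Y ≤ 4 * X →
      9 * zetaSum (3 / 2) * Y ^ 2 * zetaSum (1 + η) ≤ Real.exp M := fun Y hY0 hY => by
    refine le_trans ?_ hexpM
    have : 0 < zetaSum (1 + η) := zetaSum_pos (by linarith)
    gcongr
  have hat := mul_nonneg (abs_nonneg (a : ℝ)) (abs_nonneg t)
  have ht := abs_nonneg t
  have hL1 := (logDeriv_heckeSum_lower_bound ha (t := t) hη0 hM0
    (hmono _ (by positivity) (by rw [hX]; nlinarith))).2 σ (by linarith) (by linarith) h0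
  have hL2 := (logDeriv_heckeSum_lower_bound (a := 2 * a) (by omega) (t := 2 * t) hη0 hM0
    (hmono _ (by positivity) (by
      rw [hX]; push_cast; rw [abs_mul, abs_mul, abs_two]; nlinarith))).1
  have h341 := three_four_one a (σ := 1 + η) (by linarith) t
  have hz := hζ η hη0 (by linarith)
  set d : ℝ := 1 + η - σ with hd
  have hd0 : 0 < d := by linarith
  have hd1 : d ≤ 11 / 10 * η := by linarith
  have hinv : 1 / (11 / 10 * η) ≤ 1 / d := one_div_le_one_div_of_le hd0 hd1
  have hηinv : 1 / η = 1 / x * l := by rw [hη, one_div_div]; field_simp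
  have e1 : 1 / (11 / 10 * η) = 10 / 11 * (1 / x * l) := by rw [← hηinv]; field_simp
  have e2 : 11 / 10 / η = 11 / 10 * (1 / x * l) := by rw [← hηinv]; field_simp
  rw [e1] at hinv
  rw [e2] at hz
  have hx' := mul_lt_mul_of_pos_right hx hl0
  have hxl : 0 < 1 / x * l := by positivity
  have hd2 : d ≤ 2 * l := by linarith
  rw [hM] at hL1 hL2
  linarith

end ZeroFreeRegion

end EisensteinHecke

theorem mainTheorem7 :
    ∃ c₅ c₆ : ℝ, 0 < c₅ ∧ 0 < c₆ ∧ ∀ a : ℤ, a ≠ 0 →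
      EisensteinHecke.IsHeckeLFunction a (EisensteinHecke.heckeL a) ∧
      ∀ σ t : ℝ,
        (c₆ ≤ |t| → 1 - 1 / (c₅ * Real.log ((1 + |(a : ℝ)|) * (1 + |t|))) ≤ σ →
          EisensteinHecke.heckeL a (σ + t * Complex.I) ≠ 0) ∧
        (|t| ≤ c₆ → 1 - 1 / (c₅ * Real.log ((1 + |(a : ℝ)|) * (1 + |c₆|))) ≤ σ →
          EisensteinHecke.heckeL a (σ + t * Complex.I) ≠ 0) := by
  obtain ⟨c, hc, h⟩ := EisensteinHecke.exists_zeroFreeRegion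
  -- The region already obtained holds for every `t`, so `c₆ = 1` is an arbitrary choice: for `|t| ≤
  -- 1`, replacing `|t|` by 1 enlarges the logarithm and shrinks the region.
  refine ⟨c, 1, hc, one_pos, fun a ha => ⟨EisensteinHecke.isHeckeLFunction_heckeL ha,
    fun σ t => ⟨fun _ hσ => h a ha σ t hσ, fun ht hσ => h a ha σ t (le_trans ?_ hσ)⟩⟩⟩
  have ha1 : 1 ≤ |(a : ℝ)| := by exact_mod_cast Int.one_le_abs ha
  have h1 : 1 < (1 + |(a : ℝ)|) * (1 + |t|) := by
    nlinarith [abs_nonneg t, mul_nonneg (abs_nonneg (a : ℝ)) (abs_nonneg t)]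
  have h2 := Real.log_pos h1
  rw [abs_one]
  gcongr
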